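/- **Setting.** Let $\mathcal G$ be a finite directed acyclic graph with nodes $1,\dots,n$. A structural causal model (SCM) with graph $\mathcal G$ consists of independent continuous exogenous random vectors $U_i$, each with a Lebesgue density that is strictly positive on the set of possible values of $U_i$, and of endogenous variables $V_i=f_i\big((V_j)_{j\to i},U_i\big)$ with values in Euclidean spaces and with measurable $f_i$. The graph $\mathcal G^+$ has the nodes $V_i,U_i$, the edges of $\mathcal G$ between the $V_i$, and the edges $U_i\to V_i$. The SCM is *faithful*: whenever two distinct variables among the $V_i,U_i$ are conditionally independent given a set of endogenous variables containing neither of them, they are d-separated by this set in $\mathcal G^+$. Let $X\neq Y$ be endogenous variables (treatment and outcome, possibly vector-valued), let $O$ be a set of endogenous variables without $X$ and $Y$ (the observed covariates), and let $\underline O\subseteq O$ be those that are not descendants of $X$. The *causal exogenous set* $\mathcal U^C$ consists of the $U_i$ that are ancestors of $Y$ in $\mathcal G^+$ and are not conditionally independent of $Y$ given $X,\underline O$. Let $U^C$ be the vector of its elements; the statement holds likewise, with the same notation, if the treatment's own noise $U_X$ is left out of $\mathcal U^C$. Let $f_Y^{x,\underline o}$ be $Y$ as a function of the exogenous variables when $X$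 and $\underline O$ are set to $x$ and $\underline o$ and all other variables follow their equations. The causal effect of $X$ on $Y$ is *identifiable by covariate adjustment* for $O$ if $p(y\mid do(x))=\int p(y\mid x,o)\,p(o)\,do$ for almost all $x$, in every SCM with graph $\mathcal G$ for which $P_X\otimes P_O\ll P_{(X,O)}$. **Regularity.** For $P_O$-almost every $o$ let $D_o$ be an open subset of the support of the conditional law of $X$ given $O=o$, and let the following hold. * $p(u^c\mid x,o)\ge 0$ is a version of the conditional density of $U^C$ given $X=x,O=o$, with respect to a $\sigma$-finite measure $\nu_o$ that does not depend on $x$ (for instance Lebesgue measure), and is a probability density for every $x\in D_o$. * $x\mapsto \mathbb E_{Y|x,o}[Y]$ denotes a version of the regression function that is continuous on $D_o$. * For $\nu_o$-almost every $u^c$, both $f_Y^{x,\underline o}(u^c)$ and $p(u^c\mid x,o)$ are differentiable in $x$ on $D_o$. * For every $x\in D_o$, $f_Y^{x,\underline o}$ and $\nabla_x f_Y^{x,\underline o}$ are integrable with respect to $p(\cdot\mid x,o)\,d\nu_o$; and every $x_0\in D_o$ has a neighbourhood in $D_o$ on which $\|\nabla_x(f_Y^{x,\underline o}(u^c)\,p(u^c\mid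 x,o))\|$ is bounded, for $\nu_o$-almost every $u^c$, by a $\nu_o$-integrable function of $u^c$. **Conclusion.** The function $f_Y^{x,\underline o}$ depends on the exogenous variables only through $U^C$. For $P_O$-almost every $o$ and every $x\in D_o$ the regression function is differentiable in $x$, the expectations below exist, and $$\underbrace{\nabla_x\mathbb E_{Y|x,o}[Y]}_{\mathcal A(x,o)}=\underbrace{\mathbb E_{U^C|x,o}\big[\nabla_x f_Y^{x,\underline o}\big]}_{\mathcal C(x,o)}+\underbrace{\mathbb E_{U^C|x,o}\big[f_Y^{x,\underline o}\,\nabla_x\log p(U^C\mid x,o)\big]}_{\mathcal B(x,o)} .$$ If the causal effect of $X$ on $Y$ is identifiable by covariate adjustment for $O$, then $\mathcal B(x,o)=0$ for $P_O$-almost every $o$ and every $x\in D_o$. -/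

import Mathlib

open MeasureTheory ProbabilityTheory Topology
open scoped ENNReal

noncomputable section

namespace CausalBias

/-- The Euclidean space `ℝⁿ`. -/
abbrev E (n : ℕ) : Type := EuclideanSpace ℝ (Fin n)

/-- A directed acyclic graph; `Adj j i` is the edge `j → i`. -/
structure DAG (ι : Type) where
  Adj : ι → ι → Prop
  acyclic : ∀ i, ¬ Relation.TransGen Adj i i

theorem DAG.wf {ι : Type} [Finite ι] (G : DAG ι) : WellFounded G.Adj := by
  have : Std.Irrefl (Relation.TransGen G.Adj) := ⟨G.acyclic⟩
  exact Subrelation.wf (r := Relation.TransGen G.Adj) (fun h => Relation.TransGen.single h)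
    (Finite.wellFounded_of_trans_of_irrefl _)

/-- `i` is a (proper) descendant of `j`. -/
def DAG.IsDesc {ι : Type} (G : DAG ι) (j i : ι) : Prop := Relation.TransGen G.Adj j i

/-- The edges of the augmented graph `G⁺`: the node `Sum.inl i` is the endogenous variable `V i`,
the node `Sum.inr i` is its exogenous variable `U i`, and `U i` is an additional parent of `V i`. -/
inductive DAG.Plus {ι : Type} (G : DAG ι) : ι ⊕ ι → ι ⊕ ι → Prop
  | endo {j i : ι} : G.Adj j i → G.Plus (Sum.inl j) (Sum.inl i)
  | exo (i : ι) : G.Plus (Sum.inr i) (Sum.inl i)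

/-- `l` is a path from `a` to `b`, that is, a sequence of distinct nodes in which consecutive nodes
are joined by an edge, of either direction. -/
def IsPath {N : Type} (R : N → N → Prop) (a b : N) (l : List N) : Prop :=
  l.IsChain (fun v w => R v w ∨ R w v) ∧ l.Nodup ∧ l.head? = some a ∧ l.getLast? = some b

/-- The path `l` is unblocked (active) given `C`: each collider on it is in `C` or has a descendant
in `C`, and no other interior node of it is in `C`. -/
def IsActive {N : Type} (R : N → N → Prop) (C : Set N) (l : List N) : Prop :=
  ∀ v w z : N, [v, w, z] <:+: l →
    ((R v w ∧ R z w) → ∃ t ∈ C, Relation.ReflTransGen R w t) ∧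
    (¬ (R v w ∧ R z w) → w ∉ C)

/-- `a` and `b` are d-separated by `C`. -/
def DSep {N : Type} (R : N → N → Prop) (a b : N) (C : Set N) : Prop :=
  ∀ l : List N, IsPath R a b l → ¬ IsActive R C l

/-- A structural causal model with causal graph `G`. The endogenous variable `V i` takes values in
`ℝ^(d i)` and is given by `V i = f i (V j : j → i) (U i)`. The exogenous variable `U i` is a
continuous random vector with values in `range i ⊆ ℝ^(m i)` and has a Lebesgue density, `dens i`,
which is strictly positive on `range i`. -/
structure SCM {ι : Type} (G : DAG ι) where
  d : ι → ℕ
  m : ι → ℕ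
  f : ∀ i, (∀ j : {j // G.Adj j i}, E (d j)) → E (m i) → E (d i)
  measurable_f : ∀ i, Measurable
    (fun z : (∀ j : {j // G.Adj j i}, E (d j)) × E (m i) => f i z.1 z.2)
  range : ∀ i, Set (E (m i))
  dens : ∀ i, E (m i) → ℝ
  measurable_dens : ∀ i, Measurable (dens i)
  dens_pos : ∀ i, ∀ u ∈ range i, 0 < dens i u
  dens_zero : ∀ i, ∀ u ∉ range i, dens i u = 0
  dens_total : ∀ i, ∫⁻ u, ENNReal.ofReal (dens i u) = 1

namespace SCM

variable {ι : Type} {G : DAG ι} (M : SCM G)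

/-- Joint values of all the exogenous variables. -/
abbrev Ω : Type := ∀ i, E (M.m i)

/-- The law of the exogenous variable `U i`. -/
def exoLaw (i : ι) : Measure (E (M.m i)) :=
  volume.withDensity (fun u => ENNReal.ofReal (M.dens i u))

instance (i : ι) : IsProbabilityMeasure (M.exoLaw i) :=
  ⟨by rw [exoLaw, withDensity_apply _ MeasurableSet.univ, Measure.restrict_univ, M.dens_total]⟩

/-- The joint law of the exogenous variables, which are independent. -/
def P [Fintype ι] : Measure M.Ω := Measure.pi M.exoLaw

instance [Fintype ι] : IsProbabilityMeasure M.P := by unfold P; infer_instance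

section Eval

variable [Finite ι]

open Classical in
/-- Values of the endogenous variables, as functions of the exogenous ones, when each `V i` with
`i ∈ B` is assigned the value `b i` and all the other variables follow their equations. -/
def eval (B : Set ι) (b : ∀ i, E (M.d i)) (u : M.Ω) : ∀ i, E (M.d i) :=
  G.wf.fix (C := fun i => E (M.d i))
    (fun i rec => if i ∈ B then b i else M.f i (fun j => rec j.1 j.2) (u i))

open Classical in
theorem eval_eq (B : Set ι) (b : ∀ i, E (M.d i)) (u : M.Ω) (i : ι) :
    M.eval B b u i = if i ∈ B then b i else M.f i (fun j => M.eval B b u j.1) (u i) := by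
  unfold eval
  rw [WellFounded.fix_eq]

theorem measurable_eval (B : Set ι) (b : ∀ i, E (M.d i)) (i : ι) :
    Measurable (fun u => M.eval B b u i) := by
  induction i using G.wf.induction with
  | _ i ih =>
    by_cases hi : i ∈ B
    · simp only [M.eval_eq B b _ i, hi, if_true]
      exact measurable_const
    · simp only [M.eval_eq B b _ i, hi, if_false]
      exact (M.measurable_f i).comp
        ((measurable_pi_lambda _ fun j => ih j.1 j.2).prodMk (measurable_pi_apply i))

/-- The endogenous variable `V i` as a random variable. -/
def V (i : ι) (u : M.Ω) : E (M.d i) := M.eval ∅ 0 u i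

theorem measurable_V (i : ι) : Measurable (M.V i) := M.measurable_eval ∅ 0 i

/-- Joint values of the endogenous variables with index in `C`. -/
abbrev Val (C : Set ι) : Type := ∀ j : C, E (M.d j)

/-- The random vector of the endogenous variables with index in `C`. -/
def vec (C : Set ι) (u : M.Ω) : M.Val C := fun j => M.V j u

theorem measurable_vec (C : Set ι) : Measurable (M.vec C) :=
  measurable_pi_lambda _ fun j => M.measurable_V j

/-- The dimension of the variable at a node of `G⁺`. -/
def nodeDim : ι ⊕ ι → ℕ
  | Sum.inl i => M.d i
  | Sum.inr i => M.m i

/-- The random variable at a node of `G⁺`. -/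
def nodeVar : ∀ a : ι ⊕ ι, M.Ω → E (M.nodeDim a)
  | Sum.inl i => M.V i
  | Sum.inr i => fun u => u i

end Eval

variable [Fintype ι]

/-- The variables at the nodes `a` and `b` of `G⁺` are conditionally independent given the
endogenous variables with index in `C`. -/
def CondIndep (a b : ι ⊕ ι) (C : Set ι) : Prop :=
  CondIndepFun (MeasurableSpace.comap (M.vec C) inferInstance) (M.measurable_vec C).comap_le
    (M.nodeVar a) (M.nodeVar b) M.P

/-- Faithfulness to `G⁺`: every conditional independence that holds in the model, between two
(endogenous or exogenous) variables and given a set of endogenous variables, holds in the graph. -/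
def Faithful : Prop :=
  ∀ (a b : ι ⊕ ι) (C : Set ι), a ≠ b → a ∉ Sum.inl '' C → b ∉ Sum.inl '' C →
    M.CondIndep a b C → DSep G.Plus a b (Sum.inl '' C)

end SCM

section Treatment

variable {ι : Type} [Fintype ι] {G : DAG ι}

/-- The observed covariates that are not descendants of the treatment `X`. -/
def DAG.nonDesc {ι : Type} (G : DAG ι) (X : ι) (O : Set ι) : Set ι := {i ∈ O | ¬ G.IsDesc X i}

/-- The (indices of the) causal exogenous set: the exogenous variables that are ancestors of `Y` in
`G⁺` and are not conditionally independent of `Y` given `X` and the covariates in `O` that are not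
descendants of `X`. -/
def SCM.causalSet (M : SCM G) (X Y : ι) (O : Set ι) : Set ι :=
  {i | Relation.TransGen G.Plus (Sum.inr i) (Sum.inl Y) ∧
    ¬ M.CondIndep (Sum.inr i) (Sum.inl Y) ({X} ∪ G.nonDesc X O)}

/-- The joint law of `(X, O)`. -/
def SCM.lawXO (M : SCM G) (X : ι) (O : Set ι) : Measure (E (M.d X) × M.Val O) :=
  M.P.map (fun u => (M.V X u, M.vec O u))

/-- The law of `O`. -/
def SCM.lawO (M : SCM G) (O : Set ι) : Measure (M.Val O) := M.P.map (M.vec O)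

/-- The law of `X`. -/
def SCM.lawX (M : SCM G) (X : ι) : Measure (E (M.d X)) := M.P.map (M.V X)

/-- The conditional law of `X` given `O = o`. -/
def SCM.condX (M : SCM G) (X : ι) (O : Set ι) : Kernel (M.Val O) (E (M.d X)) :=
  condDistrib (M.V X) (M.vec O) M.P

/-- The conditional law of `Y` given `X = x` and `O = o`. -/
def SCM.condY (M : SCM G) (X Y : ι) (O : Set ι) :
    Kernel (E (M.d X) × M.Val O) (E (M.d Y)) :=
  condDistrib (M.V Y) (fun u => (M.V X u, M.vec O u)) M.P

/-- Joint values of the exogenous variables with index in `K`. -/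
abbrev SCM.ExoVal (M : SCM G) (K : Set ι) : Type := ∀ j : K, E (M.m j)

/-- The conditional law, given `X = x` and `O = o`, of the exogenous variables in `K`. -/
def SCM.condU (M : SCM G) (X : ι) (O K : Set ι) :
    Kernel (E (M.d X) × M.Val O) (M.ExoVal K) :=
  condDistrib (fun u (j : K) => u j) (fun u => (M.V X u, M.vec O u)) M.P

open Classical in
/-- The law of `Y` under the intervention that sets `X` to `x`. -/
def SCM.doLaw (M : SCM G) (X Y : ι) (x : E (M.d X)) : Measure (E (M.d Y)) :=
  M.P.map (fun u => M.eval {X} (Function.update 0 X x) u Y)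

/-- The causal effect of `X` on `Y` can be identified by covariate adjustment for `O` in the causal
graph `G`: in each structural causal model with this graph (in which the adjustment formula makes
sense, that is, the law of `(X, O)` charges whatever the product of its marginals charges),
`p(y | do(x)) = ∫ p(y | x, o) p(o) do`. -/
def DAG.IdentifiableByAdjustment (G : DAG ι) (X Y : ι) (O : Set ι) : Prop :=
  ∀ M : SCM G, (M.lawX X).prod (M.lawO O) ≪ M.lawXO X O →
    ∀ᵐ x ∂(M.lawX X), M.doLaw X Y x = (M.lawO O).bind (fun o => M.condY X Y O (x, o))

open Classical in
/-- The partial evaluation of `f_Y` with `X` set to `x` and the observed non-descendants of `X` set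
to their values in `o`; the remaining endogenous variables are expressed through their equations, so
that a function of the exogenous variables is left. -/
def SCM.fY (M : SCM G) (X Y : ι) (O : Set ι) (x : E (M.d X)) (o : M.Val O) (u : M.Ω) :
    E (M.d Y) :=
  M.eval ({X} ∪ G.nonDesc X O)
    (Function.update (fun i => if h : i ∈ O then o ⟨i, h⟩ else 0) X x) u Y

open Classical in
/-- The same partial evaluation as a function of the exogenous variables in `K` only, the others
being set to `0`. -/
def SCM.fYOn (M : SCM G) (X Y : ι) (O K : Set ι) (x : E (M.d X)) (o : M.Val O)
    (c : M.ExoVal K) : E (M.d Y) :=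
  M.fY X Y O x o (fun i => if h : i ∈ K then c ⟨i, h⟩ else 0)

/-- The measure with density `q` with respect to `ν`. -/
def densLaw {A : Type} [MeasurableSpace A] (ν : Measure A) (q : A → ℝ) : Measure A :=
  ν.withDensity (fun c => ENNReal.ofReal (q c))

/-- The average partial effect on the treated, `E_{U^K|x,o}[∇ₓ f_Y]`, where `p x o` is the density
of `U^K` given `x` and `o` with respect to `ν o`. -/
def SCM.partialEffect (M : SCM G) (X Y : ι) (O K : Set ι) (ν : M.Val O → Measure (M.ExoVal K))
    (p : E (M.d X) → M.Val O → M.ExoVal K → ℝ) (x : E (M.d X)) (o : M.Val O) :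
    E (M.d X) →L[ℝ] E (M.d Y) :=
  ∫ c, fderiv ℝ (fun x' => M.fYOn X Y O K x' o c) x ∂(densLaw (ν o) (p x o))

/-- The integrand `f_Y ∇ₓ log p(U^K|x,o)` of the causal bias, a column times a row vector. -/
def SCM.biasIntegrand (M : SCM G) (X Y : ι) (O K : Set ι)
    (p : E (M.d X) → M.Val O → M.ExoVal K → ℝ) (x : E (M.d X)) (o : M.Val O)
    (c : M.ExoVal K) : E (M.d X) →L[ℝ] E (M.d Y) :=
  (fderiv ℝ (fun x' => Real.log (p x' o c)) x).smulRight (M.fYOn X Y O K x o c)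

/-- The causal bias `E_{U^K|x,o}[f_Y ∇ₓ log p(U^K|x,o)]`. -/
def SCM.bias (M : SCM G) (X Y : ι) (O K : Set ι) (ν : M.Val O → Measure (M.ExoVal K))
    (p : E (M.d X) → M.Val O → M.ExoVal K → ℝ) (x : E (M.d X)) (o : M.Val O) :
    E (M.d X) →L[ℝ] E (M.d Y) :=
  ∫ c, M.biasIntegrand X Y O K p x o c ∂(densLaw (ν o) (p x o))

end Treatment

end CausalBias

end

/-! ### Directed paths and d-separation in the augmented graph. -/

namespace CausalBias

/-! The decomposition. At the actual values of `X` and the covariates the partial evaluation of `Y`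
equals `Y`, and it reads only those `U i` that have a directed path to `Y` avoiding `X` and the
observed non-descendants (`DAG.activeSet`). Such a path is active, so by faithfulness these `U i`
lie in the causal set (`SCM.activeSet_subset_causalSet`). Hence the regression function is, almost
everywhere, the integral of `f_Y` against `p(· | x, o)`. Differentiation under the integral sign,
the product rule and `p ∇ log p = ∇p` give the two terms (`hasFDerivAt_integral_densLaw`). Equality
almost everywhere becomes equality on `D o` because both sides are continuous and `D o` lies in the
support.

The bias. If the law of the active exogenous variables given `(x, o)` does not depend on `x`, moving
the density with `x` cannot change the expectation of `f_Y`, and the score term vanishes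
(`integral_score_eq_zero`). Two facts give this independence.

Graph to probability: remove `O` from the moral graph of the ancestors of `{X} ∪ O`, and take the
component of `X`. The exogenous variables whose family meets this component are independent of all
others given `O` (`SCM.condIndep_exoAlg`), and `X` is a function of them and of `O`.

Identifiability to graph: if an active exogenous variable were on the side of `X`, a model with this
graph would violate the adjustment formula (`DAG.IdentifiableByAdjustment.exists_separation`).
Either an observed descendant of `X` is an ancestor of `Y`, and adjustment for a mediator fails
(`DAG.not_identifiable_of_mediator`); or a sequence of common causes and observed colliders leads
from `X` to `Y` (`DAG.not_identifiable_of_chain`). Both counterexamples add bits modulo 2, and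
validity of the formula would force a biased coin to be fair. -/

theorem DAG.not_plus_inr {ι : Type} {G : DAG ι} {a : ι ⊕ ι} {i : ι} : ¬ G.Plus a (Sum.inr i) := by
  rintro ⟨⟩

theorem DAG.transGen_plus_inl {ι : Type} {G : DAG ι} {i : ι} {b : ι ⊕ ι}
    (h : Relation.TransGen G.Plus (Sum.inl i) b) :
    ∃ j, b = Sum.inl j ∧ Relation.TransGen G.Adj i j := by
  induction h with
  | single h => cases h with | endo h => exact ⟨_, rfl, .single h⟩
  | tail _ h ih =>
    obtain ⟨j, rfl, hj⟩ := ih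
    cases h with | endo h => exact ⟨_, rfl, hj.tail h⟩

theorem DAG.plus_acyclic {ι : Type} (G : DAG ι) (a : ι ⊕ ι) : ¬ Relation.TransGen G.Plus a a := by
  intro h
  rcases a with i | i
  · obtain ⟨j, hj, hij⟩ := DAG.transGen_plus_inl h
    cases hj
    exact G.acyclic i hij
  · obtain ⟨b, -, hb⟩ := Relation.TransGen.tail'_iff.1 h
    exact DAG.not_plus_inr hb

/-- A directed path that avoids `C`, except possibly at its start, is active given `C`. -/
theorem not_dSep_of_reflTransGen {N : Type} {R : N → N → Prop} {C : Set N} {a b : N}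
    (hR : ∀ v, ¬ Relation.TransGen R v v)
    (h : Relation.ReflTransGen (fun v w => R v w ∧ w ∉ C) a b) : ¬ DSep R a b C := by
  intro hsep
  obtain ⟨l, hl, hlast⟩ := List.exists_isChain_cons_of_relationReflTransGen h
  have hchain : (a :: l).IsChain R := hl.imp fun _ _ h => h.1
  refine hsep (a :: l) ⟨hchain.imp fun _ _ h => Or.inl h, ?_, rfl, ?_⟩ ?_
  · have h1 : (a :: l).IsChain (Relation.TransGen R) := hchain.imp fun _ _ h => .single h
    have h2 := List.isChain_iff_pairwise.1 h1
    refine h2.imp ?_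
    rintro v w hvw rfl
    exact hR v hvw
  · rw [List.getLast?_eq_getLast_of_ne_nil (by simp), hlast]
  -- No interior node is a collider: an edge `z → w` would close a cycle with `w → z`.
  · intro v w z hin
    have h3 := hl.infix hin
    simp only [List.isChain_cons_cons] at h3
    exact ⟨fun hc => absurd ((Relation.TransGen.single hc.2).tail h3.2.1.1) (hR z),
      fun _ => h3.1.2⟩

/-- `i` reaches `j` along a directed path whose nodes, except possibly the first one, are in `A`. -/
def DAG.Reach {ι : Type} (G : DAG ι) (A : Set ι) (i j : ι) : Prop :=
  Relation.ReflTransGen (fun v w => G.Adj v w ∧ w ∈ A) i j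

theorem DAG.Reach.mono {ι : Type} {G : DAG ι} {A A' : Set ι} (hA : A ⊆ A') {i j : ι}
    (h : G.Reach A i j) : G.Reach A' i j :=
  Relation.ReflTransGen.mono (fun _ _ h => ⟨h.1, hA h.2⟩) _ _ h

theorem DAG.Reach.reflTransGen {ι : Type} {G : DAG ι} {A : Set ι} {i j : ι}
    (h : G.Reach A i j) : Relation.ReflTransGen G.Adj i j :=
  Relation.ReflTransGen.mono (fun _ _ h => h.1) _ _ h

theorem DAG.Reach.mem {ι : Type} {G : DAG ι} {A : Set ι} {i j : ι}
    (h : G.Reach A i j) (hi : i ∈ A) : j ∈ A := by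
  rcases Relation.ReflTransGen.cases_tail h with rfl | ⟨_, _, h⟩
  exacts [hi, h.2]

/-! ### Interventions and the exogenous variables that matter. -/

namespace SCM

variable {ι : Type} {G : DAG ι} (M : SCM G)

section Eval

variable [Finite ι]

theorem eval_of_mem {B : Set ι} (b : ∀ i, E (M.d i)) (u : M.Ω) {i : ι} (hi : i ∈ B) :
    M.eval B b u i = b i := by
  rw [M.eval_eq, if_pos hi]

theorem eval_of_notMem {B : Set ι} (b : ∀ i, E (M.d i)) (u : M.Ω) {i : ι} (hi : i ∉ B) :
    M.eval B b u i = M.f i (fun j => M.eval B b u j.1) (u i) := by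
  rw [M.eval_eq, if_neg hi]

theorem V_eq (u : M.Ω) (i : ι) : M.V i u = M.f i (fun j => M.V j.1 u) (u i) :=
  M.eval_of_notMem 0 u (Set.notMem_empty i)

/-- Only the exogenous variables with a directed path to `Y` that avoids `B` matter for the value
of `Y` when the variables in `B` are set. -/
theorem eval_congr_exo {B : Set ι} (b : ∀ i, E (M.d i)) {u u' : M.Ω} (Y : ι)
    (h : ∀ i, i ∉ B → G.Reach Bᶜ i Y → u i = u' i) : M.eval B b u Y = M.eval B b u' Y := by
  induction Y using G.wf.induction with
  | _ Y ih =>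
    by_cases hY : Y ∈ B
    · rw [M.eval_of_mem b u hY, M.eval_of_mem b u' hY]
    · rw [M.eval_of_notMem b u hY, M.eval_of_notMem b u' hY, h Y hY .refl]
      congr 1
      funext j
      exact ih j.1 j.2 fun i hi hij => h i hi (hij.tail ⟨j.2, hY⟩)

/-- Setting variables to the values that they have anyway changes nothing. -/
theorem eval_eq_V {B : Set ι} {b : ∀ i, E (M.d i)} (u : M.Ω) (hb : ∀ i ∈ B, b i = M.V i u)
    (Y : ι) : M.eval B b u Y = M.V Y u := by
  induction Y using G.wf.induction with
  | _ Y ih =>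
    by_cases hY : Y ∈ B
    · rw [M.eval_of_mem b u hY, hb Y hY]
    · rw [M.eval_of_notMem b u hY, M.V_eq]
      congr 1
      funext j
      exact ih j.1 j.2

theorem measurable_eval_uncurry (B : Set ι) (i : ι) :
    Measurable (fun z : (∀ i, E (M.d i)) × M.Ω => M.eval B z.1 z.2 i) := by
  induction i using G.wf.induction with
  | _ i ih =>
    by_cases hi : i ∈ B
    · simp only [M.eval_of_mem _ _ hi]
      exact (measurable_pi_apply i).comp measurable_fst
    · simp only [M.eval_of_notMem _ _ hi]
      exact (M.measurable_f i).comp ((measurable_pi_lambda _ fun j => ih j.1 j.2).prodMk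
        ((measurable_pi_apply i).comp measurable_snd))

end Eval

variable [Fintype ι]

open Classical in
theorem measurable_fY (X Y : ι) (O : Set ι) :
    Measurable (fun z : (E (M.d X) × M.Val O) × M.Ω => M.fY X Y O z.1.1 z.1.2 z.2) := by
  have h : Measurable (fun z : (E (M.d X) × M.Val O) × M.Ω =>
      (Function.update (fun i => if h : i ∈ O then z.1.2 ⟨i, h⟩ else 0) X z.1.1 :
        ∀ i, E (M.d i))) := by
    rw [measurable_pi_iff]
    intro i
    by_cases hi : i = X
    · subst hi
      simp only [Function.update_self]
      fun_prop
    · simp only [Function.update_of_ne hi]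
      by_cases hO : i ∈ O
      · simp only [hO, dif_pos]
        exact (measurable_pi_apply (⟨i, hO⟩ : O)).comp (measurable_snd.comp measurable_fst)
      · simp only [hO, dif_neg, not_false_eq_true]
        exact measurable_const
  exact (M.measurable_eval_uncurry ({X} ∪ G.nonDesc X O) Y).comp (h.prodMk measurable_snd)

open Classical in
theorem measurable_fYOn_uncurry (X Y : ι) (O K : Set ι) :
    Measurable (fun z : (E (M.d X) × M.Val O) × M.ExoVal K => M.fYOn X Y O K z.1.1 z.1.2 z.2) := by
  have h : Measurable (fun z : (E (M.d X) × M.Val O) × M.ExoVal K =>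
      (fun i => if h : i ∈ K then z.2 ⟨i, h⟩ else 0 : M.Ω)) := by
    rw [measurable_pi_iff]
    intro i
    by_cases hi : i ∈ K
    · simp only [hi, dif_pos]
      exact (measurable_pi_apply (⟨i, hi⟩ : K)).comp measurable_snd
    · simp only [hi, dif_neg, not_false_eq_true]
      exact measurable_const
  exact (M.measurable_fY X Y O).comp (measurable_fst.prodMk h)

theorem measurable_fYOn (X Y : ι) (O K : Set ι) (x : E (M.d X)) (o : M.Val O) :
    Measurable (M.fYOn X Y O K x o) :=
  (M.measurable_fYOn_uncurry X Y O K).comp (measurable_const (a := (x, o)) |>.prodMk measurable_id)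

/-- Consistency: the partial evaluation of `Y` at the actual values is `Y`. -/
theorem fY_V_vec (X Y : ι) (O : Set ι) (u : M.Ω) :
    M.fY X Y O (M.V X u) (M.vec O u) u = M.V Y u := by
  classical
  refine M.eval_eq_V u ?_ Y
  intro i hi
  by_cases hX : i = X
  · subst hX; simp
  · rw [Function.update_of_ne hX]
    have hO : i ∈ O := (hi.resolve_left hX).1
    simp [hO, vec]

/-- The exogenous variables with a directed path to `Y` on which no variable is in `B`. -/
def _root_.CausalBias.DAG.activeSet {ι : Type} (G : DAG ι) (Y : ι) (B : Set ι) : Set ι :=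
  {i | i ∉ B ∧ G.Reach Bᶜ i Y}

/-- The directed path to `Y`, prolonged by `U i → V i`, meets no conditioned node, hence is active;
by faithfulness `U i` and `Y` are then dependent given that set. The index `X` itself is excluded
because active paths start outside the intervened set. -/
theorem activeSet_subset_causalSet (hfaith : M.Faithful) {X Y : ι} {O : Set ι} (hXY : X ≠ Y)
    (hYO : Y ∉ O) :
    G.activeSet Y ({X} ∪ G.nonDesc X O) ⊆ M.causalSet X Y O \ {X} := by
  rintro i ⟨hi, hreach⟩
  refine ⟨?_, fun h => hi (Or.inl h)⟩
  have hlift : Relation.ReflTransGen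
      (fun v w => G.Plus v w ∧ w ∉ Sum.inl '' ({X} ∪ G.nonDesc X O)) (Sum.inl i) (Sum.inl Y) := by
    refine Relation.ReflTransGen.lift Sum.inl ?_ _ _ hreach
    rintro a b ⟨hab, hb⟩
    exact ⟨.endo hab, by rintro ⟨c, hc, hcb⟩; cases hcb; exact hb hc⟩
  have hlift' := hlift.head (b := Sum.inl i) (a := Sum.inr i)
    ⟨.exo i, by rintro ⟨c, hc, hcb⟩; cases hcb; exact hi hc⟩
  refine ⟨?_, fun hCI => ?_⟩
  · exact Relation.TransGen.head' (DAG.Plus.exo i)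
      (Relation.ReflTransGen.mono (fun _ _ h => h.1) _ _ hlift)
  · refine not_dSep_of_reflTransGen G.plus_acyclic hlift' (hfaith _ _ _ (by simp) (by simp) ?_ hCI)
    rintro ⟨c, hc, hcb⟩
    cases hcb
    rcases hc with hc | hc
    · exact hXY hc.symm
    · exact hYO hc.1

theorem fY_congr {X Y : ι} {O : Set ι} {u u' : M.Ω}
    (h : ∀ i ∈ G.activeSet Y ({X} ∪ G.nonDesc X O), u i = u' i) (x : E (M.d X)) (o : M.Val O) :
    M.fY X Y O x o u = M.fY X Y O x o u' :=
  M.eval_congr_exo _ Y fun i hi hreach => h i ⟨hi, hreach⟩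

/-- The default value `0` outside `K` is harmless, since no active coordinate is overwritten. -/
theorem fY_eq_fYOn {X Y : ι} {O K : Set ι} (hK : G.activeSet Y ({X} ∪ G.nonDesc X O) ⊆ K)
    (x : E (M.d X)) (o : M.Val O) (u : M.Ω) :
    M.fY X Y O x o u = M.fYOn X Y O K x o (fun j => u j) := by
  classical
  refine M.fY_congr (fun i hi => ?_) x o
  rw [dif_pos (hK hi)]

/-- The partial evaluation of `Y` as a function of the values on a smaller set of indices. -/
theorem fYOn_restrict {X Y : ι} {O K K' : Set ι} (hK : G.activeSet Y ({X} ∪ G.nonDesc X O) ⊆ K')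
    (hK' : K' ⊆ K) (x : E (M.d X)) (o : M.Val O) (c : M.ExoVal K) :
    M.fYOn X Y O K x o c = M.fYOn X Y O K' x o (fun j => c ⟨j, hK' j.2⟩) := by
  classical
  refine M.fY_congr (fun i hi => ?_) x o
  rw [dif_pos (hK hi), dif_pos (hK' (hK hi))]

end SCM

/-- If `Z = φ (X, W)`, then the conditional law of `Z` given `X` is the image of that of `W`. -/
theorem condDistrib_comp_prodMk {Ω β γ δ : Type*} [MeasurableSpace Ω] [MeasurableSpace β]
    [MeasurableSpace γ] [StandardBorelSpace γ] [Nonempty γ]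
    [MeasurableSpace δ] [StandardBorelSpace δ] [Nonempty δ]
    {μ : Measure Ω} [IsFiniteMeasure μ] {X : Ω → β} {W : Ω → γ} (hX : Measurable X)
    (hW : Measurable W) {φ : β × γ → δ} (hφ : Measurable φ) :
    ∀ᵐ b ∂(μ.map X), condDistrib (fun ω => φ (X ω, W ω)) X μ b
      = (condDistrib W X μ b).map (fun w => φ (b, w)) := by
  have hκ : ∀ b, ((Kernel.id ×ₖ condDistrib W X μ).map φ) b
      = (condDistrib W X μ b).map (fun w => φ (b, w)) := by
    intro b
    rw [Kernel.map_apply _ hφ, Kernel.prod_apply, Kernel.id_apply, Measure.dirac_prod,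
      Measure.map_map hφ (by fun_prop)]
    rfl
  have h : condDistrib (fun ω => φ (X ω, W ω)) X μ
      =ᵐ[μ.map X] (Kernel.id ×ₖ condDistrib W X μ).map φ := by
    -- Conditional laws are determined by the joint law, which is compared on rectangles `s ×ˢ t`;
    -- there both sides measure the event that `b ∈ s` and `φ (b, w) ∈ t`.
    refine condDistrib_ae_eq_of_measure_eq_compProd X (by fun_prop) ?_
    refine Measure.ext_prod fun {s t} hs ht => ?_
    have h1 : MeasurableSet {z : β × γ | z.1 ∈ s ∧ φ z ∈ t} :=
      (measurable_fst hs).inter (hφ ht)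
    have h2 : μ.map (fun ω => (X ω, φ (X ω, W ω))) (s ×ˢ t)
        = μ.map (fun ω => (X ω, W ω)) {z : β × γ | z.1 ∈ s ∧ φ z ∈ t} := by
      rw [Measure.map_apply (by fun_prop) (hs.prod ht), Measure.map_apply (by fun_prop) h1]
      rfl
    rw [h2, ← compProd_map_condDistrib hW.aemeasurable, Measure.compProd_apply h1,
      Measure.compProd_apply_prod hs ht, ← lintegral_indicator hs]
    refine lintegral_congr fun b => ?_
    by_cases hb : b ∈ s
    · rw [Set.indicator_of_mem hb, hκ, Measure.map_apply (by fun_prop) ht]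
      congr 1
      ext w
      simp [hb]
    · rw [Set.indicator_of_notMem hb]
      have : (Prod.mk b ⁻¹' {z : β × γ | z.1 ∈ s ∧ φ z ∈ t}) = ∅ := by
        ext w; simp [hb]
      rw [this, measure_empty]
  filter_upwards [h] with b hb
  rw [hb, hκ]

/-! ### Conditional laws given treatment and covariates. -/

namespace SCM

variable {ι : Type} {G : DAG ι} (M : SCM G)

theorem measurable_exo (K : Set ι) : Measurable (fun (u : M.Ω) (j : K) => u j) :=
  measurable_pi_lambda _ fun j => measurable_pi_apply j.1

/-- The map that forgets the coordinates outside of `K'`. -/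
def restrictExo {K K' : Set ι} (h : K' ⊆ K) (c : M.ExoVal K) : M.ExoVal K' :=
  fun j => c ⟨j, h j.2⟩

theorem measurable_restrictExo {K K' : Set ι} (h : K' ⊆ K) : Measurable (M.restrictExo h) :=
  measurable_pi_lambda _ fun j => measurable_pi_apply (⟨j, h j.2⟩ : K)

variable [Fintype ι]

instance (X : ι) (O : Set ι) : IsProbabilityMeasure (M.lawXO X O) :=
  Measure.isProbabilityMeasure_map ((M.measurable_V X).prodMk (M.measurable_vec O)).aemeasurable

instance (O : Set ι) : IsProbabilityMeasure (M.lawO O) :=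
  Measure.isProbabilityMeasure_map (M.measurable_vec O).aemeasurable

instance (X : ι) : IsProbabilityMeasure (M.lawX X) :=
  Measure.isProbabilityMeasure_map (M.measurable_V X).aemeasurable

instance (X : ι) (O : Set ι) : IsMarkovKernel (M.condX X O) := by unfold condX; infer_instance

/-- A property of almost every value of `(X, O)` holds for almost every `o` and, given `o`, for
almost every `x`. -/
theorem ae_lawO_ae_condX {X : ι} {O : Set ι} {q : E (M.d X) × M.Val O → Prop}
    (h : ∀ᵐ z ∂(M.lawXO X O), q z) : ∀ᵐ o ∂(M.lawO O), ∀ᵐ x ∂(M.condX X O o), q (x, o) := by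
  have h1 : M.lawO O ⊗ₘ M.condX X O = (M.lawXO X O).map Prod.swap := by
    rw [lawO, condX, compProd_map_condDistrib (M.measurable_V X).aemeasurable, lawXO,
      Measure.map_map measurable_swap ((M.measurable_V X).prodMk (M.measurable_vec O))]
    rfl
  refine Measure.ae_ae_of_ae_compProd (p := fun z : M.Val O × E (M.d X) => q (z.2, z.1)) ?_
  rw [h1]
  exact ((MeasurableEquiv.prodComm (α := E (M.d X))
      (β := M.Val O)).measurableEmbedding.ae_map_iff).2
    h

/-- Given `x` and `o`, the law of `Y` is the image under the partial evaluation of that of the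
exogenous variables which matter. -/
theorem ae_condY_eq_map {X Y : ι} {O K : Set ι}
    (hK : G.activeSet Y ({X} ∪ G.nonDesc X O) ⊆ K) :
    ∀ᵐ z ∂(M.lawXO X O), M.condY X Y O z = (M.condU X O K z).map (M.fYOn X Y O K z.1 z.2) := by
  have h := condDistrib_comp_prodMk (μ := M.P)
    ((M.measurable_V X).prodMk (M.measurable_vec O)) (M.measurable_exo K)
    (M.measurable_fYOn_uncurry X Y O K)
  have hV : (fun u => M.fYOn X Y O K (M.V X u) (M.vec O u) (fun j : K => u j)) = M.V Y := by
    funext u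
    rw [← M.fY_eq_fYOn hK, M.fY_V_vec]
  simp only [hV] at h
  exact h

theorem ae_integral_condY {X Y : ι} {O K : Set ι}
    (hK : G.activeSet Y ({X} ∪ G.nonDesc X O) ⊆ K) :
    ∀ᵐ z ∂(M.lawXO X O), ∫ y, y ∂(M.condY X Y O z)
      = ∫ c, M.fYOn X Y O K z.1 z.2 c ∂(M.condU X O K z) := by
  filter_upwards [M.ae_condY_eq_map hK] with z hz
  rw [hz, integral_map (M.measurable_fYOn X Y O K z.1 z.2).aemeasurable]
  exact measurable_id.aestronglyMeasurable

/-- The density is given for the variables in `K`, whereas separation concerns only the active ones;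
this passes to the marginal. -/
theorem ae_condU_map_restrictExo {X : ι} {O K K' : Set ι} (h : K' ⊆ K) :
    ∀ᵐ z ∂(M.lawXO X O), (M.condU X O K z).map (M.restrictExo h) = M.condU X O K' z := by
  have := condDistrib_comp (mβ := inferInstance) (μ := M.P) (fun u => (M.V X u, M.vec O u))
    (M.measurable_exo K).aemeasurable (M.measurable_restrictExo h)
  filter_upwards [this] with z hz
  rw [condU, condU, ← Kernel.map_apply _ (M.measurable_restrictExo h), ← hz]
  rfl

end SCM

/-- A property that holds almost everywhere holds on a dense part of each open part of the
support. -/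
theorem subset_closure_of_ae {H : Type*} [TopologicalSpace H] [MeasurableSpace H] {μ : Measure H}
    {D : Set H} (hD : IsOpen D) (hsupp : D ⊆ μ.support) {q : H → Prop} (hq : ∀ᵐ x ∂μ, q x) :
    D ⊆ closure {x | x ∈ D ∧ q x} := by
  intro x hx
  rw [mem_closure_iff_nhds]
  intro U hU
  have hpos : 0 < μ (U ∩ D) :=
    (Measure.mem_support_iff_forall x).1 (hsupp hx) _ (Filter.inter_mem hU (hD.mem_nhds hx))
  have hne : (μ (U ∩ D)) ≠ 0 := hpos.ne'
  obtain ⟨y, hy, hqy⟩ := Filter.Frequently.exists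
    ((frequently_ae_mem_iff.2 hne).and_eventually hq)
  exact ⟨y, hy.1, hy.2, hqy⟩

/-! ### Laws given by densities. -/

theorem integral_densLaw {C : Type} [MeasurableSpace C] {ν : Measure C} {q : C → ℝ}
    (hq : Measurable q) (hq0 : ∀ c, 0 ≤ q c)
    {F' : Type*} [NormedAddCommGroup F'] [NormedSpace ℝ F'] (g : C → F') :
    ∫ c, g c ∂(densLaw ν q) = ∫ c, q c • g c ∂ν := by
  rw [densLaw, integral_withDensity_eq_integral_toReal_smul (by fun_prop) (by simp)]
  simp [ENNReal.toReal_ofReal (hq0 _)]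

theorem integrable_densLaw_iff {C : Type} [MeasurableSpace C] {ν : Measure C} {q : C → ℝ}
    (hq : Measurable q) (hq0 : ∀ c, 0 ≤ q c)
    {F' : Type*} [NormedAddCommGroup F'] [NormedSpace ℝ F'] {g : C → F'} :
    Integrable g (densLaw ν q) ↔ Integrable (fun c => q c • g c) ν := by
  rw [densLaw, integrable_withDensity_iff_integrable_smul' (by fun_prop) (by simp)]
  simp [ENNReal.toReal_ofReal (hq0 _)]

/-- If the densities depend continuously on the parameter, and the law of `π c` is `Q` for a dense
set of parameters, then it is `Q` for all of them. -/
theorem densLaw_map_eq_of_dense {H : Type*} [TopologicalSpace H] [FirstCountableTopology H]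
    {C : Type} [MeasurableSpace C] {C' : Type*} [MeasurableSpace C']
    {ν : Measure C} {D : Set H}
    {p : H → C → ℝ} (hpm : ∀ x, Measurable (p x))
    (hpc : ∀ᵐ c ∂ν, ∀ x ∈ D, ContinuousAt (fun x' => p x' c) x)
    (hprob : ∀ x ∈ D, IsProbabilityMeasure (densLaw ν (p x)))
    {π : C → C'} (hπ : Measurable π) {Q : Measure C'} {s : Set H}
    (hs : ∀ x ∈ s, x ∈ D ∧ (densLaw ν (p x)).map π = Q) {x : H} (hx : x ∈ D)
    (hxs : x ∈ closure s) : (densLaw ν (p x)).map π = Q := by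
  obtain ⟨y, hys, hyx⟩ := mem_closure_iff_seq_limit.1 hxs
  -- Scheffé's argument: Fatou's lemma along a sequence in `s` bounds the limit law by `Q`, and two
  -- probability measures of which one dominates the other coincide.
  have hfatou : ∀ B : Set C', MeasurableSet B → (densLaw ν (p x)).map π B ≤ Q B := by
    intro B hB
    have hval : ∀ x', (densLaw ν (p x')).map π B = ∫⁻ c in π ⁻¹' B, ENNReal.ofReal (p x' c) ∂ν := by
      intro x'
      rw [Measure.map_apply hπ hB, densLaw, withDensity_apply _ (hπ hB)]
    have hlim : ∫⁻ c in π ⁻¹' B, ENNReal.ofReal (p x c) ∂ν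
        ≤ Filter.liminf (fun n => ∫⁻ c in π ⁻¹' B, ENNReal.ofReal (p (y n) c) ∂ν) Filter.atTop := by
      refine le_trans (le_of_eq ?_)
        (lintegral_liminf_le fun n => (hpm (y n)).ennreal_ofReal)
      refine lintegral_congr_ae (ae_restrict_of_ae ?_)
      filter_upwards [hpc] with c hc
      exact ((ENNReal.continuous_ofReal.tendsto _).comp ((hc x hx).tendsto.comp hyx)).liminf_eq.symm
    rw [hval]
    refine hlim.trans (le_of_eq ?_)
    simp only [← hval, (hs _ (hys _)).2]
    simp
  have h0 := hprob x hx
  have h1 : IsProbabilityMeasure ((densLaw ν (p x)).map π) :=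
    Measure.isProbabilityMeasure_map hπ.aemeasurable
  have h2 : IsProbabilityMeasure Q := by
    have := hprob _ (hs _ (hys 0)).1
    rw [← (hs _ (hys 0)).2]
    exact Measure.isProbabilityMeasure_map hπ.aemeasurable
  exact Measure.eq_of_le_of_measure_univ_eq (Measure.le_iff.2 hfatou) (by simp)

/-! ### Differentiation of expectations under a varying density. -/

section Integral

variable {H F : Type*} {C : Type} [NormedAddCommGroup H] [NormedSpace ℝ H]
  [NormedAddCommGroup F] [NormedSpace ℝ F] [MeasurableSpace C]

theorem fderiv_smul_eq {p : H → ℝ} {f : H → F} {x : H} (hp : DifferentiableAt ℝ p x)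
    (hf : DifferentiableAt ℝ f x) :
    fderiv ℝ (fun x' => p x' • f x') x = p x • fderiv ℝ f x + (fderiv ℝ p x).smulRight (f x) :=
  fderiv_fun_smul hp hf

/-- A nonnegative density times its score is its gradient, also where the density vanishes. -/
theorem smul_fderiv_log_smulRight {p : H → ℝ} (hp0 : ∀ x, 0 ≤ p x) {x : H}
    (hp : DifferentiableAt ℝ p x) (y : F) :
    p x • (fderiv ℝ (fun x' => Real.log (p x')) x).smulRight y
      = (fderiv ℝ p x).smulRight y := by
  by_cases hx : p x = 0
  -- A zero of a nonnegative density is a minimum, so the gradient vanishes there too.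
  · have hmin : IsLocalMin p x := Filter.Eventually.of_forall fun x' => hx ▸ hp0 x'
    rw [hmin.fderiv_eq_zero, hx]
    ext v
    simp
  · rw [fderiv.log hp hx]
    ext v
    simp [smul_smul, hx]


variable [FiniteDimensional ℝ H]

/-- Expansion in a finite basis of `H` reduces the measurability of a family of operators to that of
its values on vectors. -/
theorem aestronglyMeasurable_clm {ν : Measure C} {L : C → H →L[ℝ] F}
    (hL : ∀ v, AEStronglyMeasurable (fun c => L c v) ν) : AEStronglyMeasurable L ν := by
  let b := Module.finBasis ℝ H
  have h : L = fun c => ∑ i, ((b.coord i).toContinuousLinearMap.smulRight (L c (b i))) := by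
    funext c
    refine ContinuousLinearMap.coe_injective (b.ext fun j => ?_)
    simp [Finsupp.single_apply]
  rw [h]
  refine Finset.aestronglyMeasurable_fun_sum _ fun i _ => ?_
  have hc : Continuous (fun y : F => (b.coord i).toContinuousLinearMap.smulRight y) :=
    (ContinuousLinearMap.smulRightL ℝ H F (b.coord i).toContinuousLinearMap).continuous
  exact hc.comp_aestronglyMeasurable (hL (b i))

/-- Each directional derivative is a limit of the difference quotients with step `1/n`. -/
theorem aestronglyMeasurable_fderiv_param {ν : Measure C} {f : H → C → F}
    (hf : ∀ x, AEStronglyMeasurable (f x) ν) {x : H}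
    (hd : ∀ᵐ c ∂ν, DifferentiableAt ℝ (fun x' => f x' c) x) :
    AEStronglyMeasurable (fun c => fderiv ℝ (fun x' => f x' c) x) ν := by
  refine aestronglyMeasurable_clm fun v => ?_
  refine aestronglyMeasurable_of_tendsto_ae Filter.atTop
    (f := fun (n : ℕ) c => (n : ℝ) • (f (x + (n : ℝ)⁻¹ • v) c - f x c)) (fun n => ?_) ?_
  · exact ((hf _).sub (hf x)).const_smul (n : ℝ)
  · filter_upwards [hd] with c hc
    exact (hc.hasFDerivAt.lim_real v).comp tendsto_natCast_atTop_atTop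

variable [MeasurableSpace F] [BorelSpace F] [SecondCountableTopology F]

theorem hasFDerivAt_integral_smul {ν : Measure C} {D : Set H} (hD : IsOpen D)
    {p : H → C → ℝ} {f : H → C → F} (hpm : ∀ x, Measurable (p x)) (hfm : ∀ x, Measurable (f x))
    (hpd : ∀ᵐ c ∂ν, ∀ x ∈ D, DifferentiableAt ℝ (fun x' => p x' c) x)
    (hfd : ∀ᵐ c ∂ν, ∀ x ∈ D, DifferentiableAt ℝ (fun x' => f x' c) x)
    {x₀ : H} (hx₀ : x₀ ∈ D) (hint : Integrable (fun c => p x₀ c • f x₀ c) ν)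
    (hdom : ∃ ε > 0, ∃ g : C → ℝ, Integrable g ν ∧ ∀ᵐ c ∂ν, ∀ x ∈ Metric.ball x₀ ε ∩ D,
      ‖fderiv ℝ (fun x' => p x' c • f x' c) x‖ ≤ g c) :
    Integrable (fun c => fderiv ℝ (fun x' => p x' c • f x' c) x₀) ν ∧
      HasFDerivAt (fun x => ∫ c, p x c • f x c ∂ν)
        (∫ c, fderiv ℝ (fun x' => p x' c • f x' c) x₀ ∂ν) x₀ := by
  obtain ⟨ε, hε, g, hg, hbound⟩ := hdom
  have hs : Metric.ball x₀ ε ∩ D ∈ 𝓝 x₀ :=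
    Filter.inter_mem (Metric.ball_mem_nhds _ hε) (hD.mem_nhds hx₀)
  have hmeas : ∀ x, AEStronglyMeasurable (fun c => p x c • f x c) ν := fun x =>
    ((hpm x).smul (hfm x)).aestronglyMeasurable
  have hdiff : ∀ᵐ c ∂ν, ∀ x ∈ D, DifferentiableAt ℝ (fun x' => p x' c • f x' c) x := by
    filter_upwards [hpd, hfd] with c h1 h2 x hx
    exact (h1 x hx).smul (h2 x hx)
  have hmeas' : AEStronglyMeasurable (fun c => fderiv ℝ (fun x' => p x' c • f x' c) x₀) ν :=
    aestronglyMeasurable_fderiv_param hmeas (hdiff.mono fun c h => h x₀ hx₀)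
  refine ⟨hg.mono' hmeas' (hbound.mono fun c h => h x₀ ⟨Metric.mem_ball_self hε, hx₀⟩), ?_⟩
  refine hasFDerivAt_integral_of_dominated_of_fderiv_le hs (.of_forall hmeas) hint hmeas'
    hbound hg ?_
  filter_upwards [hdiff] with c hc x hx
  exact (hc x hx.2).hasFDerivAt

/-- Differentiation of the expectation of `f x` under a law with a density `p x` that depends on
`x`: the derivative of `f` and the score of `p` contribute. -/
theorem hasFDerivAt_integral_densLaw {ν : Measure C} {D : Set H} (hD : IsOpen D)
    {p : H → C → ℝ} {f : H → C → F} (hpm : ∀ x, Measurable (p x)) (hp0 : ∀ x c, 0 ≤ p x c)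
    (hfm : ∀ x, Measurable (f x))
    (hpd : ∀ᵐ c ∂ν, ∀ x ∈ D, DifferentiableAt ℝ (fun x' => p x' c) x)
    (hfd : ∀ᵐ c ∂ν, ∀ x ∈ D, DifferentiableAt ℝ (fun x' => f x' c) x)
    {x₀ : H} (hx₀ : x₀ ∈ D) (hint : Integrable (f x₀) (densLaw ν (p x₀)))
    (hdint : Integrable (fun c => fderiv ℝ (fun x' => f x' c) x₀) (densLaw ν (p x₀)))
    (hdom : ∃ ε > 0, ∃ g : C → ℝ, Integrable g ν ∧ ∀ᵐ c ∂ν, ∀ x ∈ Metric.ball x₀ ε ∩ D,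
      ‖fderiv ℝ (fun x' => p x' c • f x' c) x‖ ≤ g c) :
    Integrable (fun c => (fderiv ℝ (fun x' => Real.log (p x' c)) x₀).smulRight (f x₀ c))
        (densLaw ν (p x₀)) ∧
      HasFDerivAt (fun x => ∫ c, f x c ∂(densLaw ν (p x)))
        (∫ c, fderiv ℝ (fun x' => f x' c) x₀ ∂(densLaw ν (p x₀))
          + ∫ c, (fderiv ℝ (fun x' => Real.log (p x' c)) x₀).smulRight (f x₀ c)
            ∂(densLaw ν (p x₀))) x₀ := by
  rw [integrable_densLaw_iff (hpm _) (hp0 _)] at hint hdint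
  obtain ⟨hi, hder⟩ := hasFDerivAt_integral_smul hD hpm hfm hpd hfd hx₀ hint hdom
  -- The score term is the difference of two integrable terms, so its integrability need not be
  -- assumed.
  have heq : ∀ᵐ c ∂ν, p x₀ c • (fderiv ℝ (fun x' => Real.log (p x' c)) x₀).smulRight (f x₀ c)
      = fderiv ℝ (fun x' => p x' c • f x' c) x₀ - p x₀ c • fderiv ℝ (fun x' => f x' c) x₀ := by
    filter_upwards [hpd, hfd] with c h1 h2
    rw [smul_fderiv_log_smulRight (fun x => hp0 x c) (h1 x₀ hx₀),
      fderiv_smul_eq (h1 x₀ hx₀) (h2 x₀ hx₀), add_sub_cancel_left]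
  refine ⟨?_, ?_⟩
  · rw [integrable_densLaw_iff (hpm _) (hp0 _)]
    exact (hi.sub hdint).congr (heq.mono fun c h => h.symm)
  · simp only [integral_densLaw (hpm _) (hp0 _)]
    rw [integral_congr_ae heq, integral_sub hi hdint, add_sub_cancel]
    exact hder

/-- If `f` depends only on `π c`, and the law of `π c` does not depend on `x`, then the score of the
density does not contribute to the derivative of the expectation of `f`. -/
theorem integral_score_eq_zero {C' : Type*} [MeasurableSpace C'] {ν : Measure C} {D : Set H}
    (hD : IsOpen D) {p : H → C → ℝ} {f : H → C → F} (hpm : ∀ x, Measurable (p x))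
    (hp0 : ∀ x c, 0 ≤ p x c) (hfm : ∀ x, Measurable (f x))
    (hpd : ∀ᵐ c ∂ν, ∀ x ∈ D, DifferentiableAt ℝ (fun x' => p x' c) x)
    (hfd : ∀ᵐ c ∂ν, ∀ x ∈ D, DifferentiableAt ℝ (fun x' => f x' c) x)
    {π : C → C'} (hπ : Measurable π) {f' : H → C' → F} (hf'm : ∀ x, Measurable (f' x))
    (hff' : ∀ x c, f x c = f' x (π c))
    {x₀ : H} (hx₀ : x₀ ∈ D) (hprob : IsProbabilityMeasure (densLaw ν (p x₀)))
    (hlaw : ∀ x ∈ D, (densLaw ν (p x)).map π = (densLaw ν (p x₀)).map π)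
    (hint : Integrable (f x₀) (densLaw ν (p x₀)))
    (hdint : Integrable (fun c => fderiv ℝ (fun x' => f x' c) x₀) (densLaw ν (p x₀)))
    (hdom : ∃ ε > 0, ∃ g : C → ℝ, Integrable g ν ∧ ∀ᵐ c ∂ν, ∀ x ∈ Metric.ball x₀ ε ∩ D,
      ‖fderiv ℝ (fun x' => p x' c • f x' c) x‖ ≤ g c) :
    ∫ c, (fderiv ℝ (fun x' => Real.log (p x' c)) x₀).smulRight (f x₀ c) ∂(densLaw ν (p x₀))
      = 0 := by
  have hp1 : Integrable (p x₀) ν := by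
    have h := (integrable_densLaw_iff (ν := ν) (hpm x₀) (hp0 x₀)).1 (integrable_const (1 : ℝ))
    simpa using h
  have hscore := (hasFDerivAt_integral_densLaw hD hpm hp0 hfm hpd hfd hx₀ hint hdint hdom).1
  rw [integrable_densLaw_iff (hpm _) (hp0 _)] at hint hdint hscore
  rw [integral_densLaw (hpm _) (hp0 _)]
  set h : C → H →L[ℝ] F := fun c =>
    p x₀ c • (fderiv ℝ (fun x' => Real.log (p x' c)) x₀).smulRight (f x₀ c) with hh
  have heq : ∀ᵐ c ∂ν, h c
      = fderiv ℝ (fun x' => p x' c • f x' c) x₀ - p x₀ c • fderiv ℝ (fun x' => f x' c) x₀ := by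
    filter_upwards [hpd, hfd] with c h1 h2
    rw [hh]
    simp only
    rw [smul_fderiv_log_smulRight (fun x => hp0 x c) (h1 x₀ hx₀),
      fderiv_smul_eq (h1 x₀ hx₀) (h2 x₀ hx₀), add_sub_cancel_left]
  obtain ⟨ε₀, hε₀, hball⟩ := Metric.isOpen_iff.1 hD x₀ hx₀
  -- With the density frozen at `x₀`, the derivative of `f` has no integrable bound, since
  -- domination is assumed only for the product `p • f`. The sets `A n` restore one: on them `f'`
  -- grows at rate at most `n` within distance `1/(n+1)` of `x₀`. They lie in `C'`, so that the
  -- truncation still depends on `π c` alone, and a countable dense family of test points makes them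
  -- measurable.
  let d := TopologicalSpace.denseSeq H
  let A : ℕ → Set C' := fun n => {c' | ∀ k, d k ∈ Metric.ball x₀ (1 / ((n : ℝ) + 1)) →
    ‖f' (d k) c' - f' x₀ c'‖ ≤ n * ‖d k - x₀‖}
  have hA : ∀ n, MeasurableSet (A n) := by
    intro n
    have : A n = ⋂ k, {c' | d k ∈ Metric.ball x₀ (1 / ((n : ℝ) + 1)) →
        ‖f' (d k) c' - f' x₀ c'‖ ≤ n * ‖d k - x₀‖} := by
      ext c'; simp [A]
    rw [this]
    refine MeasurableSet.iInter fun k => ?_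
    by_cases hk : d k ∈ Metric.ball x₀ (1 / ((n : ℝ) + 1))
    · simp only [hk, true_imp_iff]
      exact measurableSet_le (((hf'm _).sub (hf'm _)).norm) measurable_const
    · simp only [hk, false_imp_iff]
      exact MeasurableSet.univ
  -- every point is eventually in the truncation set
  have hev : ∀ᵐ c ∂ν, ∀ᶠ n in Filter.atTop, c ∈ π ⁻¹' (A n) := by
    filter_upwards [hfd] with c hc
    obtain ⟨K, hK⟩ := (hc x₀ hx₀).hasFDerivAt.isBigO_sub.bound
    obtain ⟨δ, hδ, hδK⟩ := Metric.eventually_nhds_iff_ball.1 hK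
    obtain ⟨n₀, hn₀⟩ := exists_nat_ge K
    obtain ⟨n₁, hn₁⟩ := exists_nat_one_div_lt hδ
    filter_upwards [Filter.eventually_ge_atTop n₀, Filter.eventually_ge_atTop n₁] with n h0 h1 k hk
    have hk' : d k ∈ Metric.ball x₀ δ := by
      refine Metric.ball_subset_ball ?_ hk
      refine le_trans ?_ hn₁.le
      gcongr
    have := hδK _ hk'
    rw [hff', hff'] at this
    refine this.trans ?_
    gcongr
    exact hn₀.trans (by exact_mod_cast h0)
  -- the truncated integrals vanish
  have hzero : ∀ᶠ n : ℕ in Filter.atTop, ∫ c, (π ⁻¹' (A n)).indicator h c ∂ν = 0 := by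
    obtain ⟨n₀, hn₀⟩ := exists_nat_one_div_lt hε₀
    filter_upwards [Filter.eventually_ge_atTop n₀] with n hn
    have hS : MeasurableSet (π ⁻¹' (A n)) := hπ (hA n)
    have hρ : (0 : ℝ) < 1 / ((n : ℝ) + 1) := by positivity
    have hsub : Metric.ball x₀ (1 / ((n : ℝ) + 1)) ⊆ D := by
      refine (Metric.ball_subset_ball ?_).trans hball
      refine le_trans ?_ hn₀.le
      gcongr
    rw [integral_indicator hS]
    set μ := ν.restrict (π ⁻¹' (A n)) with hμ
    have hpd' := ae_restrict_of_ae (s := π ⁻¹' (A n)) hpd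
    have hfd' := ae_restrict_of_ae (s := π ⁻¹' (A n)) hfd
    obtain ⟨hi1, hd1⟩ := hasFDerivAt_integral_smul (ν := μ) hD hpm hfm hpd' hfd' hx₀ hint.restrict
      (by
        obtain ⟨ε, hε, g, hg, hgb⟩ := hdom
        exact ⟨ε, hε, g, hg.restrict, ae_restrict_of_ae hgb⟩)
    -- On the truncation set the frozen density admits the integrable bound `n * p x₀`.
    have hd2 : HasFDerivAt (fun x => ∫ c, p x₀ c • f x c ∂μ)
        (∫ c, p x₀ c • fderiv ℝ (fun x' => f x' c) x₀ ∂μ) x₀ := by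
      refine (hasFDerivAt_integral_of_dominated_loc_of_lip' (bound := fun c => n * p x₀ c)
        (Metric.ball_mem_nhds x₀ hρ) (fun x _ => ((hpm x₀).smul (hfm x)).aestronglyMeasurable)
        hint.restrict hdint.1.restrict ?_ (hp1.restrict.const_mul _) ?_).2
      · filter_upwards [hfd', ae_restrict_mem hS] with c hc hcS x hx
        -- The bound passes from the dense points to the whole ball by continuity of `f` in the
        -- parameter.
        have hkey : ‖f x c - f x₀ c‖ ≤ n * ‖x - x₀‖ := by
          by_contra hlt
          push Not at hlt
          have hcx : ContinuousAt (fun x' => f x' c) x := (hc x (hsub hx)).continuousAt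
          have h1 : ∀ᶠ x' in 𝓝 x, n * ‖x' - x₀‖ < ‖f x' c - f x₀ c‖ := by
            refine ContinuousAt.eventually_lt ?_ ?_ hlt
            · fun_prop
            · exact (hcx.sub continuousAt_const).norm
          have h2 : ∀ᶠ x' in 𝓝 x, x' ∈ Metric.ball x₀ (1 / ((n : ℝ) + 1)) :=
            Metric.isOpen_ball.mem_nhds hx
          obtain ⟨_, ⟨k, rfl⟩, h1', h2'⟩ :=
            (TopologicalSpace.denseRange_denseSeq H).inter_nhds_nonempty (h1.and h2)
          have := hcS k h2'
          rw [← hff', ← hff'] at this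
          exact absurd this (not_le.2 h1')
        change ‖p x₀ c • f x c - p x₀ c • f x₀ c‖ ≤ n * p x₀ c * ‖x - x₀‖
        rw [← smul_sub, norm_smul, Real.norm_of_nonneg (hp0 _ _)]
        calc p x₀ c * ‖f x c - f x₀ c‖ ≤ p x₀ c * (n * ‖x - x₀‖) :=
              mul_le_mul_of_nonneg_left hkey (hp0 _ _)
          _ = n * p x₀ c * ‖x - x₀‖ := by ring
      · filter_upwards [hfd'] with c hc
        exact (hc x₀ hx₀).hasFDerivAt.const_smul (p x₀ c)
    -- Both integrals are integrals of the truncated `f'` against the law of `π c`, which is the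
    -- same for `p x` and `p x₀`.
    have hval : ∀ x ∈ D, ∫ c, p x c • f x c ∂μ = ∫ c, p x₀ c • f x c ∂μ := by
      have key : ∀ x y, ∫ c, p y c • f x c ∂μ
          = ∫ c', (A n).indicator (f' x) c' ∂((densLaw ν (p y)).map π) := by
        intro x y
        rw [integral_map hπ.aemeasurable
            ((hf'm x).indicator (hA n)).aestronglyMeasurable,
          integral_densLaw (hpm _) (hp0 _), hμ, ← integral_indicator hS]
        refine integral_congr_ae (.of_forall fun c => ?_)
        by_cases hc : π c ∈ A n
        · simp [Set.indicator, hc, hff']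
        · simp [Set.indicator, hc]
      intro x hx
      rw [key, key, hlaw x hx]
    have hd1' : HasFDerivAt (fun x => ∫ c, p x₀ c • f x c ∂μ)
        (∫ c, fderiv ℝ (fun x' => p x' c • f x' c) x₀ ∂μ) x₀ := by
      refine hd1.congr_of_eventuallyEq ?_
      filter_upwards [hD.mem_nhds hx₀] with x hx
      exact (hval x hx).symm
    -- The same function has been differentiated twice, with moving and with frozen density; the
    -- difference of the two derivatives is the truncated score integral.
    rw [integral_congr_ae (ae_restrict_of_ae heq), integral_sub hi1 hdint.restrict,
      hd1'.unique hd2, sub_self]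
  have hlim : Filter.Tendsto (fun n => ∫ c, (π ⁻¹' (A n)).indicator h c ∂ν) Filter.atTop
      (𝓝 (∫ c, h c ∂ν)) := by
    refine tendsto_integral_of_dominated_convergence (fun c => ‖h c‖)
      (fun n => hscore.1.indicator (hπ (hA n))) hscore.norm
      (fun n => .of_forall fun c => norm_indicator_le_norm_self _ _) ?_
    filter_upwards [hev] with c hc
    refine tendsto_const_nhds.congr' ?_
    filter_upwards [hc] with n hn
    rw [Set.indicator_of_mem hn]
  exact tendsto_nhds_unique hlim (tendsto_const_nhds.congr' (hzero.mono fun n h => h.symm))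

end Integral

/-! ### Conditional independence of σ-algebras. -/

section CondIndepSup

theorem integrable_indicator_one {Ω : Type*} [MeasurableSpace Ω] {μ : Measure Ω}
    [IsFiniteMeasure μ] {t : Set Ω} (ht : MeasurableSet t) :
    Integrable (t.indicator fun _ => (1 : ℝ)) μ :=
  (integrable_const _).indicator ht

theorem sup_eq_generateFrom_inter {Ω : Type*} (m₁ m₂ : MeasurableSpace Ω) :
    m₁ ⊔ m₂ = MeasurableSpace.generateFrom
      {s | ∃ a b, MeasurableSet[m₁] a ∧ MeasurableSet[m₂] b ∧ s = a ∩ b} := by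
  refine le_antisymm (sup_le ?_ ?_) (MeasurableSpace.generateFrom_le ?_)
  · exact fun a ha => MeasurableSpace.measurableSet_generateFrom
      ⟨a, Set.univ, ha, @MeasurableSet.univ _ m₂, by simp⟩
  · exact fun b hb => MeasurableSpace.measurableSet_generateFrom
      ⟨Set.univ, b, @MeasurableSet.univ _ m₁, hb, by simp⟩
  · rintro _ ⟨a, b, ha, hb, rfl⟩
    exact @MeasurableSet.inter _ (m₁ ⊔ m₂) _ _ ((le_sup_left : m₁ ≤ m₁ ⊔ m₂) a ha)
      ((le_sup_right : m₂ ≤ m₁ ⊔ m₂) b hb)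

theorem isPiSystem_inter {Ω : Type*} (m₁ m₂ : MeasurableSpace Ω) :
    IsPiSystem {s | ∃ a b, MeasurableSet[m₁] a ∧ MeasurableSet[m₂] b ∧ s = a ∩ b} := by
  rintro _ ⟨a, b, ha, hb, rfl⟩ _ ⟨a', b', ha', hb', rfl⟩ -
  exact ⟨a ∩ a', b ∩ b', ha.inter ha', hb.inter hb', Set.inter_inter_inter_comm a b a' b'⟩

variable {Ω : Type*} {m m' A B C mΩ : MeasurableSpace Ω} [StandardBorelSpace Ω] {μ : Measure Ω}
  [IsProbabilityMeasure μ]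

/-- Conditional independence says that further conditioning is immaterial. -/
theorem condExp_sup_of_condIndep (hm : m ≤ mΩ) (hA : A ≤ mΩ) (hB : B ≤ mΩ)
    (h : CondIndep m A B hm μ) {t : Set Ω} (ht : MeasurableSet[B] t) :
    μ⟦t|m ⊔ A⟧ =ᵐ[μ] μ⟦t|m⟧ := by
  have hmul := (condIndep_iff m A B hm hA hB μ).1 h
  have hint := integrable_indicator_one (μ := μ) (hB t ht)
  have hle : m ⊔ A ≤ mΩ := sup_le hm hA
  have hsm : StronglyMeasurable[m ⊔ A] (μ⟦t|m⟧) := stronglyMeasurable_condExp.mono le_sup_left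
  refine (ae_eq_condExp_of_forall_setIntegral_eq hle hint
    (fun s _ _ => integrable_condExp.integrableOn) (fun s hs _ => ?_)
    hsm.aestronglyMeasurable).symm
  refine MeasurableSpace.induction_on_inter (m := m ⊔ A)
    (C := fun s _ => ∫ x in s, (μ⟦t|m⟧) x ∂μ = ∫ x in s, t.indicator (fun _ => (1 : ℝ)) x ∂μ)
    (sup_eq_generateFrom_inter m A) (isPiSystem_inter m A) ?_ ?_ ?_ ?_ s hs
  · simp
  · rintro _ ⟨a, b, ha, hb, rfl⟩
    have e1 : ∫ x in a ∩ b, (μ⟦t|m⟧) x ∂μ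
        = ∫ x in a, ((b.indicator fun _ => (1 : ℝ)) * (μ⟦t|m⟧)) x ∂μ := by
      rw [Set.inter_comm, ← Measure.restrict_restrict (hA b hb), ← integral_indicator (hA b hb)]
      refine integral_congr_ae (.of_forall fun x => ?_)
      by_cases hx : x ∈ b <;> simp [hx]
    have e2 : ∫ x in a ∩ b, t.indicator (fun _ => (1 : ℝ)) x ∂μ
        = ∫ x in a, (b ∩ t).indicator (fun _ => (1 : ℝ)) x ∂μ := by
      rw [Set.inter_comm, ← Measure.restrict_restrict (hA b hb), ← integral_indicator (hA b hb)]
      refine integral_congr_ae (.of_forall fun x => ?_)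
      by_cases hx : x ∈ b <;> by_cases hx' : x ∈ t <;> simp [hx, hx']
    have hbint := integrable_indicator_one (μ := μ) (hA b hb)
    have hprod : Integrable ((b.indicator fun _ => (1 : ℝ)) * (μ⟦t|m⟧)) μ := by
      have : (b.indicator fun _ => (1 : ℝ)) * (μ⟦t|m⟧) = b.indicator (μ⟦t|m⟧) := by
        funext x
        by_cases hx : x ∈ b <;> simp [hx]
      rw [this]
      exact integrable_condExp.indicator (hA b hb)
    rw [e1, e2, ← setIntegral_condExp hm hprod ha,
      ← setIntegral_condExp hm (integrable_indicator_one ((hA b hb).inter (hB t ht))) ha]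
    -- After conditioning on `m` the integrands are `μ⟦b|m⟧ * μ⟦t|m⟧` and `μ⟦b ∩ t|m⟧`, which agree
    -- by conditional independence.
    refine integral_congr_ae (ae_restrict_of_ae ?_)
    exact (condExp_mul_of_stronglyMeasurable_right stronglyMeasurable_condExp hprod hbint).trans
      (hmul b t hb ht).symm
  · intro s hs ih
    have h1 := integral_add_compl (μ := μ) (hle s hs) (integrable_condExp (m := m)
      (f := t.indicator fun _ => (1 : ℝ)))
    have h2 := integral_add_compl (hle s hs) hint
    rw [integral_condExp hm] at h1
    linarith
  · intro f hf hfm ih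
    rw [integral_iUnion (fun i => hle _ (hfm i)) hf integrable_condExp.integrableOn,
      integral_iUnion (fun i => hle _ (hfm i)) hf hint.integrableOn]
    exact tsum_congr ih

/-- Tower property: condition `a ∩ t` first on `m ⊔ A`, where the indicator of `a` factors out, and
then on `m`. -/
theorem condIndep_of_condExp_sup (hm : m ≤ mΩ) (hA : A ≤ mΩ) (hB : B ≤ mΩ)
    (h : ∀ t, MeasurableSet[B] t → μ⟦t|m ⊔ A⟧ =ᵐ[μ] μ⟦t|m⟧) : CondIndep m A B hm μ := by
  rw [condIndep_iff m A B hm hA hB μ]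
  intro a t ha ht
  have hle : m ⊔ A ≤ mΩ := sup_le hm hA
  have hint := integrable_indicator_one (μ := μ) (hB t ht)
  have haint := integrable_indicator_one (μ := μ) (hA a ha)
  have hsplit : (a ∩ t).indicator (fun _ => (1 : ℝ))
      = (a.indicator fun _ => (1 : ℝ)) * (t.indicator fun _ => (1 : ℝ)) := by
    funext x
    by_cases hx : x ∈ a <;> by_cases hx' : x ∈ t <;> simp [hx, hx']
  have hainter := integrable_indicator_one (μ := μ) ((hA a ha).inter (hB t ht))
  have hprod : Integrable ((a.indicator fun _ => (1 : ℝ)) * (μ⟦t|m⟧)) μ := by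
    have : (a.indicator fun _ => (1 : ℝ)) * (μ⟦t|m⟧) = a.indicator (μ⟦t|m⟧) := by
      funext x
      by_cases hx : x ∈ a <;> simp [hx]
    rw [this]
    exact integrable_condExp.indicator (hA a ha)
  have hsm : StronglyMeasurable[m ⊔ A] (a.indicator fun _ => (1 : ℝ)) :=
    (@stronglyMeasurable_const _ _ (m ⊔ A) _ 1).indicator ((le_sup_right : A ≤ m ⊔ A) a ha)
  have h1 : μ⟦a ∩ t|m ⊔ A⟧ =ᵐ[μ] (a.indicator fun _ => (1 : ℝ)) * (μ⟦t|m⟧) := by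
    have h1' := condExp_mul_of_stronglyMeasurable_left (μ := μ) hsm (hsplit ▸ hainter) hint
    rw [← hsplit] at h1'
    exact h1'.trans ((Filter.EventuallyEq.refl _ _).mul (h t ht))
  have h2 : μ⟦a ∩ t|m⟧ =ᵐ[μ] μ[(a.indicator fun _ => (1 : ℝ)) * (μ⟦t|m⟧)|m] :=
    (condExp_condExp_of_le le_sup_left hle).symm.trans (condExp_congr_ae h1)
  exact h2.trans (condExp_mul_of_stronglyMeasurable_right stronglyMeasurable_condExp hprod haint)

/-- For `m'` between `m` and `m ⊔ A`, the conditional expectation given `m ⊔ A` is already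
`m`-measurable, so projecting it to `m'` does not change it. -/
theorem condExp_eq_of_le_sup (hm : m ≤ mΩ) (hA : A ≤ mΩ) (hB : B ≤ mΩ)
    (h : CondIndep m A B hm μ) (h1 : m ≤ m') (h2 : m' ≤ m ⊔ A)
    {t : Set Ω} (ht : MeasurableSet[B] t) : μ⟦t|m'⟧ =ᵐ[μ] μ⟦t|m⟧ := by
  have hle : m ⊔ A ≤ mΩ := sup_le hm hA
  refine (condExp_condExp_of_le h2 hle).symm.trans ?_
  refine (condExp_congr_ae (condExp_sup_of_condIndep hm hA hB h ht)).trans ?_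
  rw [condExp_of_stronglyMeasurable (h2.trans hle) (stronglyMeasurable_condExp.mono h1)
    integrable_condExp]

/-- Weak union: what is a function of `A` may be added to the condition. -/
theorem condIndep_of_le_sup (hm : m ≤ mΩ) (hA : A ≤ mΩ) (hB : B ≤ mΩ)
    (h : CondIndep m A B hm μ) (h1 : m ≤ m') (h2 : m' ≤ m ⊔ A) :
    CondIndep m' A B (h2.trans (sup_le hm hA)) μ := by
  refine condIndep_of_condExp_sup (h2.trans (sup_le hm hA)) hA hB fun t ht => ?_
  refine (condExp_eq_of_le_sup hm hA hB h (h1.trans le_sup_left) (sup_le h2 le_sup_right) ht).trans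
    (condExp_eq_of_le_sup hm hA hB h h1 h2 ht).symm

theorem condIndep_left_of_le_sup (hm : m ≤ mΩ) (hA : A ≤ mΩ) (hB : B ≤ mΩ)
    (h : CondIndep m A B hm μ) (hC : C ≤ m ⊔ A) : CondIndep m C B hm μ := by
  refine condIndep_of_condExp_sup hm (hC.trans (sup_le hm hA)) hB fun t ht => ?_
  exact condExp_eq_of_le_sup hm hA hB h le_sup_left (sup_le le_sup_left hC) ht

theorem condIndep_bot_of_indep (hA : A ≤ mΩ) (hB : B ≤ mΩ) (h : Indep A B μ) :
    CondIndep ⊥ A B bot_le μ := by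
  refine condIndep_of_condExp_sup bot_le hA hB fun t ht => ?_
  have hsm : StronglyMeasurable[B] (t.indicator fun _ => (1 : ℝ)) :=
    (@stronglyMeasurable_const _ _ B _ 1).indicator ht
  rw [bot_sup_eq]
  exact (condExp_indep_eq hB hA hsm h.symm).trans
    (condExp_indep_eq hB bot_le hsm (indep_bot_right B)).symm

end CondIndepSup

/-! ### A Markov property for the exogenous variables. -/

namespace SCM

section Algebras

variable {ι : Type} {G : DAG ι} (M : SCM G)

/-- The σ-algebra generated by the exogenous variables with index in `J`. -/
@[reducible]
noncomputable def exoAlg (J : Set ι) : MeasurableSpace M.Ω :=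
  ⨆ i ∈ J, MeasurableSpace.comap (fun u : M.Ω => u i) inferInstance

theorem comap_exo_le_exoAlg {J : Set ι} {i : ι} (hi : i ∈ J) :
    MeasurableSpace.comap (fun u : M.Ω => u i) inferInstance ≤ M.exoAlg J :=
  le_iSup₂ (f := fun i (_ : i ∈ J) => MeasurableSpace.comap (fun u : M.Ω => u i) inferInstance) i hi

theorem exoAlg_le (J : Set ι) : M.exoAlg J ≤ MeasurableSpace.pi :=
  iSup₂_le fun i _ => (measurable_pi_apply i).comap_le

variable [Finite ι]

/-- The σ-algebra generated by the endogenous variables with index in `L`. -/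
@[reducible]
noncomputable def endoAlg (L : Set ι) : MeasurableSpace M.Ω :=
  ⨆ i ∈ L, MeasurableSpace.comap (M.V i) inferInstance

theorem comap_V_le_endoAlg {L : Set ι} {i : ι} (hi : i ∈ L) :
    MeasurableSpace.comap (M.V i) inferInstance ≤ M.endoAlg L :=
  le_iSup₂ (f := fun i (_ : i ∈ L) => MeasurableSpace.comap (M.V i) inferInstance) i hi

theorem endoAlg_le (L : Set ι) : M.endoAlg L ≤ MeasurableSpace.pi :=
  iSup₂_le fun i _ => (M.measurable_V i).comap_le

theorem comap_vec (O : Set ι) : MeasurableSpace.comap (M.vec O) inferInstance = M.endoAlg O := by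
  have h : MeasurableSpace.comap (M.vec O) inferInstance
      = ⨆ j : O, MeasurableSpace.comap (M.V j) inferInstance := by
    simp only [MeasurableSpace.pi, MeasurableSpace.comap_iSup, MeasurableSpace.comap_comp]
    rfl
  rw [h, endoAlg, iSup_subtype']

/-- The structural equation makes `V k` a measurable function of its parents and its noise. -/
theorem comap_V_le {m : MeasurableSpace M.Ω} {k : ι}
    (hpa : ∀ j, G.Adj j k → MeasurableSpace.comap (M.V j) inferInstance ≤ m)
    (hU : MeasurableSpace.comap (fun u : M.Ω => u k) inferInstance ≤ m) :
    MeasurableSpace.comap (M.V k) inferInstance ≤ m := by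
  have h1 : @Measurable _ _ m _ (fun u (j : {j // G.Adj j k}) => M.V j.1 u) :=
    @measurable_pi_lambda _ _ _ m _ _ fun j => measurable_iff_comap_le.2 (hpa j.1 j.2)
  have h2 : @Measurable _ _ m _ (fun u : M.Ω => u k) := measurable_iff_comap_le.2 hU
  have h3 : @Measurable _ _ m _ (M.V k) := by
    have := (M.measurable_f k).comp (h1.prodMk h2)
    have he : M.V k = (fun z : (∀ j : {j // G.Adj j k}, E (M.d j)) × E (M.m k) => M.f k z.1 z.2) ∘
        fun u => (fun j : {j // G.Adj j k} => M.V j.1 u, u k) := by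
      funext u
      exact M.V_eq u k
    rw [he]
    exact this
  exact measurable_iff_comap_le.1 h3

/-- If the parents outside of `O` of variables in `J` are in `S`, then the variables in `S` are
functions of those in `O` and of the exogenous variables in `J`. -/
theorem comap_V_le_of_side {L O S J : Set ι} {m : MeasurableSpace M.Ω}
    (hL : ∀ k ∈ L, ∀ j, G.Adj j k → j ∈ L)
    (hobs : ∀ j ∈ L, j ∈ O → MeasurableSpace.comap (M.V j) inferInstance ≤ m)
    (hexo : ∀ j ∈ J, MeasurableSpace.comap (fun u : M.Ω => u j) inferInstance ≤ m)
    (hSJ : ∀ k ∈ L, k ∉ O → k ∈ S → k ∈ J)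
    (hfam : ∀ k ∈ L, k ∈ J → ∀ s, G.Adj s k → s ∉ O → s ∈ S) (j : ι) (hj : j ∈ L) (hjO : j ∉ O)
    (hjS : j ∈ S) : MeasurableSpace.comap (M.V j) inferInstance ≤ m := by
  induction j using G.wf.induction with
  | _ j ih =>
    have hjJ := hSJ j hj hjO hjS
    refine M.comap_V_le (fun i hi => ?_) (hexo j hjJ)
    by_cases hiO : i ∈ O
    · exact hobs i (hL j hj i hi) hiO
    · exact ih i hi (hL j hj i hi) hiO (hfam j hj hjJ i hi hiO)

end Algebras

variable {ι : Type} [Fintype ι] {G : DAG ι} (M : SCM G)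

theorem indep_exoAlg (J : Set ι) : Indep (M.exoAlg J) (M.exoAlg Jᶜ) M.P := by
  have h : iIndepFun (fun (i : ι) (u : M.Ω) => u i) M.P :=
    iIndepFun_pi (X := fun _ => id) fun _ => aemeasurable_id
  exact indep_iSup_of_disjoint (fun i => (measurable_pi_apply i).comap_le) h disjoint_compl_right

theorem _root_.CausalBias.DAG.exists_maximal {ι : Type} [Finite ι] (G : DAG ι) {L : Set ι}
    (hL : L.Nonempty) : ∃ k ∈ L, ∀ j ∈ L, ¬ G.Adj k j := by
  have : Std.Irrefl (fun a b => Relation.TransGen G.Adj b a) := ⟨G.acyclic⟩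
  have : IsTrans ι (fun a b => Relation.TransGen G.Adj b a) := ⟨fun _ _ _ h h' => h'.trans h⟩
  have hwf : WellFounded (fun a b => Relation.TransGen G.Adj b a) :=
    Finite.wellFounded_of_trans_of_irrefl _
  obtain ⟨k, hk, hmin⟩ := hwf.has_min L hL
  exact ⟨k, hk, fun j hj hkj => hmin j hj (.single hkj)⟩

theorem endoAlg_insert (L : Set ι) (k : ι) :
    M.endoAlg (insert k L) = M.endoAlg L ⊔ MeasurableSpace.comap (M.V k) inferInstance := by
  rw [endoAlg, iSup_insert, sup_comm]

/-- Let `W` be an ancestral set with `O ⊆ W`. If in each family within `W`, the members that are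
not in `O` are on one side (in `S` if its child is in `J`, outside of `S` otherwise), then the
exogenous variables in `J` are independent of the others, given the variables in `O`. -/
theorem condIndep_exoAlg {W O S J : Set ι} (hW : ∀ k ∈ W, ∀ j, G.Adj j k → j ∈ W) (hOW : O ⊆ W)
    (hJ : ∀ k ∈ W, k ∈ J → ∀ s, s = k ∨ G.Adj s k → s ∉ O → s ∈ S)
    (hJ' : ∀ k ∈ W, k ∉ J → ∀ s, s = k ∨ G.Adj s k → s ∉ O → s ∉ S) :
    ProbabilityTheory.CondIndep (M.endoAlg O) (M.exoAlg J) (M.exoAlg Jᶜ) (M.endoAlg_le O) M.P := by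
  classical
  -- Induction over ancestral subsets `L` of `W`, conditioning on `O ∩ L` only. Without conditions
  -- this is the independence of the noise. A node of `L` without children in `L` is removed, which
  -- leaves an ancestral set.
  have key : ∀ L : Finset ι, (∀ k ∈ L, ∀ j, G.Adj j k → j ∈ L) → (L : Set ι) ⊆ W →
      ProbabilityTheory.CondIndep (M.endoAlg (O ∩ L)) (M.exoAlg J) (M.exoAlg Jᶜ)
        (M.endoAlg_le _) M.P := by
    intro L
    induction L using Finset.strongInduction with
    | H L ih =>
      intro hL hLW
      rcases L.eq_empty_or_nonempty with rfl | hne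
      · have h0 : M.endoAlg (O ∩ (∅ : Finset ι)) = ⊥ := by simp [endoAlg]
        have := condIndep_bot_of_indep (M.exoAlg_le J) (M.exoAlg_le Jᶜ) (M.indep_exoAlg J)
        convert this
      · obtain ⟨k, hkL, hmax⟩ := G.exists_maximal (L := (L : Set ι)) hne
        have hL' : ∀ i ∈ L.erase k, ∀ j, G.Adj j i → j ∈ L.erase k := by
          intro i hi j hji
          refine Finset.mem_erase.2 ⟨?_, hL i (Finset.mem_of_mem_erase hi) j hji⟩
          rintro rfl
          exact hmax i (Finset.mem_of_mem_erase hi) hji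
        have hLW' : ((L.erase k : Finset ι) : Set ι) ⊆ W := fun i hi =>
          hLW (Finset.mem_of_mem_erase hi)
        have hprev := ih (L.erase k) (Finset.erase_ssubset hkL) hL' hLW'
        have hpa : ∀ j, G.Adj j k → j ∈ L.erase k := fun j hj => by
          refine Finset.mem_erase.2 ⟨?_, hL k hkL j hj⟩
          rintro rfl
          exact G.acyclic j (.single hj)
        by_cases hkO : k ∈ O
        · have hset : O ∩ (L : Set ι) = insert k (O ∩ (L.erase k : Finset ι)) := by
            ext i
            by_cases hik : i = k
            · subst hik; simp [hkO, hkL]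
            · simp [hik]
          -- The unobserved part of the family of `k` is on one side, so `V k` is a function of
          -- earlier observed variables and of the noise of that side; weak union then moves it into
          -- the condition. The side is left arbitrary, to serve for `S, J` and for the complements.
          have hk : ∀ S' J' : Set ι,
              (∀ i ∈ W, i ∉ O → i ∈ S' → i ∈ J') →
              (∀ i ∈ W, i ∈ J' → ∀ s, G.Adj s i → s ∉ O → s ∈ S') → k ∈ J' →
              MeasurableSpace.comap (M.V k) inferInstance
                ≤ M.endoAlg (O ∩ (L.erase k : Finset ι)) ⊔ M.exoAlg J' := by
            intro S' J' h1 h2 hkJ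
            have hobs : ∀ j ∈ L.erase k, j ∈ O → MeasurableSpace.comap (M.V j) inferInstance
                ≤ M.endoAlg (O ∩ (L.erase k : Finset ι)) ⊔ M.exoAlg J' := fun j hj hjO =>
              (M.comap_V_le_endoAlg (L := O ∩ (L.erase k : Finset ι)) ⟨hjO, hj⟩).trans le_sup_left
            have hexo : ∀ j ∈ J', MeasurableSpace.comap (fun u : M.Ω => u j) inferInstance
                ≤ M.endoAlg (O ∩ (L.erase k : Finset ι)) ⊔ M.exoAlg J' := fun j hj =>
              (M.comap_exo_le_exoAlg hj).trans le_sup_right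
            refine M.comap_V_le (fun j hj => ?_) (hexo k hkJ)
            by_cases hjO : j ∈ O
            · exact hobs j (hpa j hj) hjO
            · exact M.comap_V_le_of_side (L := (L.erase k : Finset ι)) hL' hobs hexo
                (fun i hi => h1 i (hLW' hi)) (fun i hi => h2 i (hLW' hi)) j (hpa j hj) hjO
                (h2 k (hLW hkL) hkJ j hj hjO)
          have h1 : M.endoAlg (O ∩ (L.erase k : Finset ι)) ≤ M.endoAlg (O ∩ (L : Set ι)) := by
            rw [hset, endoAlg_insert]
            exact le_sup_left
          by_cases hkJ : k ∈ J
          · refine condIndep_of_le_sup (M.endoAlg_le _) (M.exoAlg_le _) (M.exoAlg_le _) hprev h1 ?_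
            rw [hset, endoAlg_insert]
            refine sup_le le_sup_left (hk S J ?_ ?_ hkJ)
            · intro i hi hiO hiS
              by_contra hiJ
              exact hJ' i hi hiJ i (Or.inl rfl) hiO hiS
            · exact fun i hi hiJ s hs hsO => hJ i hi hiJ s (Or.inr hs) hsO
          · refine ProbabilityTheory.CondIndep.symm (condIndep_of_le_sup (M.endoAlg_le _)
              (M.exoAlg_le _)
              (M.exoAlg_le _) hprev.symm h1 ?_)
            rw [hset, endoAlg_insert]
            refine sup_le le_sup_left (hk Sᶜ Jᶜ ?_ ?_ hkJ)
            · exact fun i hi hiO hiS hiJ => hiS (hJ i hi hiJ i (Or.inl rfl) hiO)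
            · exact fun i hi hiJ s hs hsO => hJ' i hi hiJ s (Or.inr hs) hsO
        · have hset : O ∩ (L : Set ι) = O ∩ (L.erase k : Finset ι) := by
            ext i
            simp only [Set.mem_inter_iff, Finset.mem_coe, Finset.mem_erase]
            refine ⟨fun h => ⟨h.1, ?_, h.2⟩, fun h => ⟨h.1, h.2.2⟩⟩
            rintro rfl
            exact hkO h.1
          convert hprev
  have hfin := key W.toFinite.toFinset
    (fun k hk j hj => by simp only [Set.Finite.mem_toFinset] at hk ⊢; exact hW k hk j hj) (by simp)
  have hset : O ∩ (W.toFinite.toFinset : Set ι) = O := by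
    simpa using hOW
  convert hfin
  exact hset.symm

/-- In the situation of `condIndep_exoAlg`, if `X` is in `S`, then its value is irrelevant for the
conditional law given `O` of the exogenous variables outside of `J`. -/
theorem ae_condU_eq_of_separation {W O S J K : Set ι} {X : ι}
    (hW : ∀ k ∈ W, ∀ j, G.Adj j k → j ∈ W)
    (hOW : O ⊆ W) (hJ : ∀ k ∈ W, k ∈ J → ∀ s, s = k ∨ G.Adj s k → s ∉ O → s ∈ S)
    (hJ' : ∀ k ∈ W, k ∉ J → ∀ s, s = k ∨ G.Adj s k → s ∉ O → s ∉ S)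
    (hXW : X ∈ W) (hXO : X ∉ O) (hXS : X ∈ S) (hK : Disjoint K J) :
    ∀ᵐ z ∂(M.lawXO X O),
      M.condU X O K z = condDistrib (fun (u : M.Ω) (j : K) => u j) (M.vec O) M.P z.2 := by
  have h := M.condIndep_exoAlg hW hOW hJ hJ'
  -- As `X` is on the side of `J`, it is a function of the observed variables and of the noise in
  -- `J`, so it inherits the independence from the noise in `K`.
  have hX : MeasurableSpace.comap (M.V X) inferInstance ≤ M.endoAlg O ⊔ M.exoAlg J := by
    refine M.comap_V_le_of_side hW (fun j _ hj => (M.comap_V_le_endoAlg hj).trans le_sup_left)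
      (fun j hj => (M.comap_exo_le_exoAlg hj).trans le_sup_right) ?_
      (fun i hi hiJ s hs hsO => hJ i hi hiJ s (Or.inr hs) hsO) X hXW hXO hXS
    intro i hi hiO hiS
    by_contra hiJ
    exact hJ' i hi hiJ i (Or.inl rfl) hiO hiS
  have hKle : MeasurableSpace.comap (fun (u : M.Ω) (j : K) => u j) inferInstance
      ≤ M.exoAlg Jᶜ := by
    simp only [MeasurableSpace.pi, MeasurableSpace.comap_iSup, MeasurableSpace.comap_comp]
    exact iSup_le fun j => M.comap_exo_le_exoAlg (Set.disjoint_left.1 hK j.2)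
  have h2 : ProbabilityTheory.CondIndep (M.endoAlg O) (MeasurableSpace.comap (M.V X) inferInstance)
      (MeasurableSpace.comap (fun (u : M.Ω) (j : K) => u j) inferInstance) (M.endoAlg_le O) M.P :=
    condIndep_of_condIndep_of_le_right
      (condIndep_left_of_le_sup (M.endoAlg_le _) (M.exoAlg_le _) (M.exoAlg_le _) h hX) hKle
  have h3 : CondIndepFun (MeasurableSpace.comap (M.vec O) inferInstance)
      (M.measurable_vec O).comap_le (M.V X) (fun (u : M.Ω) (j : K) => u j) M.P := by
    rw [condIndepFun_iff_condIndep]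
    convert h2
    exact M.comap_vec O
  rw [condIndepFun_iff_condDistrib_prod_ae_eq_prodMkRight (M.measurable_exo K) (M.measurable_V X)
    (M.measurable_vec O), condDistrib_ae_eq_iff_measure_eq_compProd _
      (M.measurable_exo K).aemeasurable] at h3
  have hXOm := (M.measurable_V X).prodMk (M.measurable_vec O)
  have hOXm := (M.measurable_vec O).prodMk (M.measurable_V X)
  have h4 : condDistrib (fun (u : M.Ω) (j : K) => u j) (fun u => (M.V X u, M.vec O u)) M.P
      =ᵐ[M.P.map (fun u => (M.V X u, M.vec O u))]
        (condDistrib (fun (u : M.Ω) (j : K) => u j) (M.vec O) M.P).prodMkLeft (E (M.d X)) := by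
    -- The known identity conditions on `(O, X)`; swapping the coordinates of the test set turns it
    -- into one for `(X, O)`.
    refine condDistrib_ae_eq_of_measure_eq_compProd _ (M.measurable_exo K).aemeasurable ?_
    refine Measure.ext_prod fun {s t} hs ht => ?_
    have h5 := congrArg (fun μ => μ ((Prod.swap ⁻¹' s) ×ˢ t)) h3
    have hs' : MeasurableSet (Prod.swap ⁻¹' s : Set (M.Val O × E (M.d X))) := measurable_swap hs
    rw [Measure.compProd_apply_prod hs' ht, setLIntegral_map hs' (Kernel.measurable_coe _ ht) hOXm,
      Measure.map_apply (hOXm.prodMk (M.measurable_exo K)) (hs'.prod ht)] at h5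
    rw [Measure.compProd_apply_prod hs ht, setLIntegral_map hs (Kernel.measurable_coe _ ht) hXOm,
      Measure.map_apply (hXOm.prodMk (M.measurable_exo K)) (hs.prod ht)]
    exact h5
  exact h4

end SCM

/-! ### Uniform noise and encodings by real numbers. -/

section UniformNoise

/-- The points of the real line of dimension one, written as a Euclidean space, in the unit
interval. -/
def unitRange : Set (E 1) := {u | u 0 ∈ Set.Icc (0 : ℝ) 1}

theorem measurableSet_unitRange : MeasurableSet unitRange :=
  measurableSet_Icc.preimage (by fun_prop : Measurable fun u : E 1 => u 0)

theorem measurePreserving_coord : MeasurePreserving (fun u : E 1 => u 0) :=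
  (volume_preserving_funUnique (Fin 1) ℝ).comp (PiLp.volume_preserving_ofLp (Fin 1))

open Classical in
theorem lintegral_unitRange :
    ∫⁻ u : E 1, ENNReal.ofReal (unitRange.indicator (fun _ => (1 : ℝ)) u) = 1 := by
  have h : (fun u : E 1 => ENNReal.ofReal (unitRange.indicator (fun _ => (1 : ℝ)) u))
      = unitRange.indicator fun _ => 1 := by
    funext u
    by_cases hu : u ∈ unitRange <;> simp [hu]
  rw [h, lintegral_indicator measurableSet_unitRange, setLIntegral_one, unitRange]
  have := measurePreserving_coord.measure_preimage
    (measurableSet_Icc (a := (0 : ℝ)) (b := 1)).nullMeasurableSet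
  rw [Real.volume_Icc, sub_zero, ENNReal.ofReal_one] at this
  exact this

/-- Each law on a standard Borel space is the law of a function of a uniform variable. -/
theorem exists_map_unitRange {B : Type*} [MeasurableSpace B] [StandardBorelSpace B] [Nonempty B]
    (μ : Measure B) [IsProbabilityMeasure μ] :
    ∃ g : E 1 → B, Measurable g ∧ (volume.restrict unitRange).map g = μ := by
  obtain ⟨f, hf, hfμ⟩ := μ.exists_measurable_map_eq
  have hproj : Measurable (Set.projIcc (0 : ℝ) 1 zero_le_one) := continuous_projIcc.measurable
  refine ⟨fun u => f (Set.projIcc 0 1 zero_le_one (u 0)), by fun_prop, ?_⟩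
  have h1 : (volume.restrict unitRange).map (fun u : E 1 => u 0)
      = volume.restrict (Set.Icc (0 : ℝ) 1) :=
    (measurePreserving_coord.restrict_preimage measurableSet_Icc).map_eq
  have h2 : (volume : Measure (Set.Icc (0 : ℝ) 1)).map Subtype.val
      = volume.restrict (Set.Icc (0 : ℝ) 1) :=
    (measurePreserving_subtype_coe measurableSet_Icc).map_eq
  have h3 : (volume.restrict unitRange).map
        (fun u : E 1 => f (Set.projIcc (0 : ℝ) 1 zero_le_one (u 0)))
      = ((volume.restrict unitRange).map (fun u : E 1 => u 0)).map
        (fun t => f (Set.projIcc (0 : ℝ) 1 zero_le_one t)) := by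
    rw [Measure.map_map (by fun_prop) (by fun_prop)]
    rfl
  rw [h3, h1, ← h2, Measure.map_map (by fun_prop) (by fun_prop)]
  convert hfμ using 2
  funext t
  simp

/-- A standard Borel space can be embedded into the one-dimensional Euclidean space. -/
theorem exists_encoding (A : Type*) [MeasurableSpace A] [StandardBorelSpace A] [Nonempty A] :
    ∃ (enc : A → E 1) (dec : E 1 → A), Measurable enc ∧ Measurable dec ∧ ∀ a, dec (enc a) = a := by
  have he := measurableEmbedding_embeddingReal A
  refine ⟨fun a => WithLp.toLp 2 fun _ => embeddingReal A a, fun y => he.invFun (y 0), ?_, ?_, ?_⟩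
  · have := he.measurable
    fun_prop
  · exact he.measurable_invFun.comp (by fun_prop)
  · intro a
    exact he.leftInverse_invFun a

end UniformNoise

/-! ### Testing identifiability on models with finitely many values. -/

section FiniteModel

variable {ι : Type} [Fintype ι] {G : DAG ι}

/-- Each system of structural equations has a solution. -/
theorem DAG.exists_solution (G : DAG ι) {A : Type} (φ : ∀ i, ({j // G.Adj j i} → A) → A) :
    ∃ v : ι → A, ∀ i, v i = φ i (fun j => v j.1) :=
  ⟨G.wf.fix (C := fun _ => A) fun i rec => φ i (fun j => rec j.1 j.2),
    fun i => G.wf.fix_eq _ i⟩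

variable {A B : Type} [MeasurableSpace A] [MeasurableSpace B]

/-- The structural causal model with uniform exogenous variables in which the values `A` of the
endogenous variables and the values `B` of the noise are encoded by real numbers. -/
noncomputable def SCM.ofFinite [Finite A] [MeasurableSingletonClass A]
    [Finite B] [MeasurableSingletonClass B]
    (φ : ∀ i, ({j // G.Adj j i} → A) → B → A) {enc : A → E 1} {dec : E 1 → A} {g : E 1 → B}
    (henc : Measurable enc) (hdec : Measurable dec) (hg : Measurable g) : SCM G where
  d _ := 1
  m _ := 1
  f i pa u := enc (φ i (fun j => dec (pa j)) (g u))
  measurable_f i := by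
    have h1 : Measurable (fun z : ({j // G.Adj j i} → A) × B => φ i z.1 z.2) :=
      measurable_of_finite _
    have h2 : Measurable (fun z : (∀ _ : {j // G.Adj j i}, E 1) × E 1 =>
        ((fun j => dec (z.1 j), g z.2) : ({j // G.Adj j i} → A) × B)) := by
      fun_prop
    exact henc.comp (h1.comp h2)
  range _ := unitRange
  dens _ := unitRange.indicator fun _ => 1
  measurable_dens _ := measurable_const.indicator measurableSet_unitRange
  dens_pos _ u hu := by simp [hu]
  dens_zero _ u hu := by simp [hu]
  dens_total _ := lintegral_unitRange

section OfFinite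

variable [Finite A] [MeasurableSingletonClass A] [Finite B] [MeasurableSingletonClass B]
  {φ : ∀ i, ({j // G.Adj j i} → A) → B → A} {enc : A → E 1} {dec : E 1 → A} {g : E 1 → B}
  (henc : Measurable enc) (hdec : Measurable dec) (hg : Measurable g)

theorem SCM.ofFinite_V (hde : ∀ a, dec (enc a) = a) {v : (ι → B) → ι → A}
    (hv : ∀ ω i, v ω i = φ i (fun j => v ω j.1) (ω i))
    (u : (SCM.ofFinite (φ := φ) henc hdec hg).Ω) (i : ι) :
    (SCM.ofFinite (φ := φ) henc hdec hg).V i u = enc (v (fun i => g (u i)) i) := by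
  induction i using G.wf.induction with
  | _ i ih =>
    rw [SCM.V_eq, hv]
    change enc (φ i (fun j => dec ((SCM.ofFinite (φ := φ) henc hdec hg).V j.1 u)) (g (u i))) = _
    congr 2
    funext j
    rw [ih j.1 j.2, hde]

theorem SCM.ofFinite_eval (hde : ∀ a, dec (enc a) = a) {X : ι} {x : A} {v : (ι → B) → ι → A}
    (hvX : ∀ ω, v ω X = x) (hv : ∀ ω i, i ≠ X → v ω i = φ i (fun j => v ω j.1) (ω i))
    {b : ∀ i, E ((SCM.ofFinite (φ := φ) henc hdec hg).d i)} (hb : b X = enc x)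
    (u : (SCM.ofFinite (φ := φ) henc hdec hg).Ω) (i : ι) :
    (SCM.ofFinite (φ := φ) henc hdec hg).eval {X} b u i = enc (v (fun i => g (u i)) i) := by
  induction i using G.wf.induction with
  | _ i ih =>
    by_cases hi : i = X
    · subst hi
      rw [SCM.eval_of_mem _ _ _ (Set.mem_singleton i), hvX, hb]
    · rw [SCM.eval_of_notMem _ _ _ (by simpa using hi), hv _ _ hi]
      change enc (φ i (fun j => dec ((SCM.ofFinite (φ := φ) henc hdec hg).eval {X} b u j.1))
        (g (u i))) = _
      congr 2
      funext j
      rw [ih j.1 j.2, hde]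

theorem SCM.ofFinite_map_P {μ : Measure B} [IsProbabilityMeasure μ]
    (hgμ : (volume.restrict unitRange).map g = μ) :
    (SCM.ofFinite (φ := φ) henc hdec hg).P.map (fun u i => g (u i))
      = Measure.pi fun _ : ι => μ := by
  have hlaw : ∀ i, (SCM.ofFinite (φ := φ) henc hdec hg).exoLaw i = volume.restrict unitRange := by
    intro i
    rw [← withDensity_indicator_one measurableSet_unitRange]
    change volume.withDensity
      (fun u => ENNReal.ofReal (unitRange.indicator (fun _ => (1 : ℝ)) u)) = _
    congr 1
    funext u
    by_cases hu : u ∈ unitRange <;> simp [hu]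
  have hlaw' : ∀ i, ((SCM.ofFinite (φ := φ) henc hdec hg).exoLaw i).map g = μ := fun i => by
    rw [hlaw i]; exact hgμ
  have hsf : ∀ i, SigmaFinite (((SCM.ofFinite (φ := φ) henc hdec hg).exoLaw i).map g) := fun i => by
    rw [hlaw']; infer_instance
  have := Measure.pi_map_pi (μ := (SCM.ofFinite (φ := φ) henc hdec hg).exoLaw)
    (f := fun _ => g) (hμ := hsf) (fun _ => hg.aemeasurable)
  rw [SCM.P]
  refine this.trans ?_
  congr 1
  funext i
  exact hlaw' i

end OfFinite

/-- Identifiability by adjustment, applied to a model with finitely many values in which an event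
about `Y` is a function of `X` and of the covariates, and in which each combination of a value of
`X` and of a value of the covariates is possible. -/
theorem DAG.IdentifiableByAdjustment.measure_eq {X Y : ι} {O : Set ι}
    (hid : G.IdentifiableByAdjustment X Y O) [Finite A] [MeasurableSingletonClass A]
    [Finite B] [MeasurableSingletonClass B] {N : SCM G}
    {enc : ∀ i, A → E (N.d i)} {dec : ∀ i, E (N.d i) → A} (hdec : ∀ i, Measurable (dec i))
    (hde : ∀ i a, dec i (enc i a) = a) {noise : N.Ω → ι → B} {Q : Measure (ι → B)}
    (hPQ : ∀ S : Set (ι → B), N.P {u | noise u ∈ S} = Q S)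
    (hQpos : ∀ ω, Q {ω} ≠ 0) {v : (ι → B) → ι → A} (hV : ∀ i u, N.V i u = enc i (v (noise u) i))
    {vd : A → (ι → B) → A}
    (hdo : ∀ x u b, b X = enc X x → N.eval {X} b u Y = enc Y (vd x (noise u)))
    (T : Set A) (h : A → (O → A) → Prop)
    (hT : ∀ ω, v ω Y ∈ T ↔ h (v ω X) (fun j => v ω j))
    (hpos : ∀ ω ω', ∃ ω'', v ω'' X = v ω X ∧ ∀ j ∈ O, v ω'' j = v ω' j) (ω₀ : ι → B) :
    Q {ω | vd (v ω₀ X) ω ∈ T} = Q {ω | h (v ω₀ X) (fun j => v ω j)} := by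
  -- Every noise configuration has positive mass, so a null event about the noise is empty.
  have hnull : ∀ S : Set (ι → B), N.P {u | noise u ∈ S} = 0 → S = ∅ := by
    intro S hS
    rw [hPQ] at hS
    by_contra hne
    obtain ⟨ω, hω⟩ := Set.nonempty_iff_ne_empty.2 hne
    exact hQpos ω (measure_mono_null (Set.singleton_subset_iff.2 hω) hS)
  have hXOm := (N.measurable_V X).prodMk (N.measurable_vec O)
  have hvec : ∀ u, N.vec O u = fun j : O => enc j (v (noise u) j) :=
    fun u => funext fun j => hV j u
  have hac : (N.lawX X).prod (N.lawO O) ≪ N.lawXO X O := by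
    refine Measure.AbsolutelyContinuous.mk fun S hS hS0 => ?_
    rw [SCM.lawXO, Measure.map_apply hXOm hS] at hS0
    have hempty := hnull {ω | ((enc X (v ω X), fun j : O => enc j (v ω j)) :
      E (N.d X) × N.Val O) ∈ S} (by
        convert hS0 using 2
        ext u
        simp only [Set.mem_preimage, Set.mem_ofPred_eq, hV, hvec])
    rw [SCM.lawX, SCM.lawO, Measure.map_prod_map _ _ (N.measurable_V X) (N.measurable_vec O),
      Measure.map_apply ((N.measurable_V X).prodMap (N.measurable_vec O)) hS]
    convert measure_empty (μ := N.P.prod N.P)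
    rw [Set.eq_empty_iff_forall_notMem]
    rintro ⟨u, u'⟩ hu
    -- Any value of `X` and any value of the covariates occur together in one configuration; this is
    -- why the joint law charges what the product of the marginals charges.
    obtain ⟨ω'', h1, h2⟩ := hpos (noise u) (noise u')
    refine (Set.eq_empty_iff_forall_notMem.1 hempty) ω'' ?_
    have h3 : ((enc X (v ω'' X), fun j : O => enc j (v ω'' j)) : E (N.d X) × N.Val O)
        = (N.V X u, N.vec O u') := by
      refine Prod.ext ?_ ?_
      · simp only [hV, h1]
      · funext j
        simp only [SCM.vec, hV, h2 j j.2]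
    change ((enc X (v ω'' X), fun j : O => enc j (v ω'' j)) : E (N.d X) × N.Val O) ∈ S
    rw [h3]
    exact hu
  have hadj := hid N hac
  set T' : Set (E (N.d Y)) := dec Y ⁻¹' T with hT'
  have hT'm : MeasurableSet T' := hdec Y (Set.toFinite T).measurableSet
  set H : Set (E (N.d X) × N.Val O) := {z | h (dec X z.1) (fun j => dec j (z.2 j))} with hH
  have hHm : MeasurableSet H := by
    have h1 : Measurable (fun z : E (N.d X) × N.Val O =>
        ((dec X z.1, fun j => dec j (z.2 j)) : A × (O → A))) :=
      ((hdec X).comp measurable_fst).prodMk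
        (measurable_pi_lambda _ fun j =>
          (hdec j).comp ((measurable_pi_apply j).comp measurable_snd))
    exact h1 (Set.toFinite {q : A × (O → A) | h q.1 q.2}).measurableSet
  have hpre : N.V Y ⁻¹' T' = (fun u => (N.V X u, N.vec O u)) ⁻¹' H := by
    ext u
    simp only [Set.mem_preimage, hT', hH, Set.mem_ofPred_eq, SCM.vec, hV]
    rw [hde, hde, hT]
    simp only [hde]
  -- The event that `Y` decodes into `T` is determined by `(X, O)`, so its conditional probability
  -- is an indicator.
  have hcond : ∀ᵐ z ∂(N.lawXO X O), N.condY X Y O z T' = H.indicator 1 z := by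
    rw [SCM.lawXO, ae_map_iff hXOm.aemeasurable
      (measurableSet_eq_fun (Kernel.measurable_coe _ hT'm) (measurable_one.indicator hHm))]
    have h1 := condDistrib_ae_eq_condExp (μ := N.P) hXOm (N.measurable_V Y) hT'm
    have h2 : N.P⟦N.V Y ⁻¹' T'|MeasurableSpace.comap (fun u => (N.V X u, N.vec O u)) inferInstance⟧
        = (N.V Y ⁻¹' T').indicator fun _ => (1 : ℝ) := by
      refine condExp_of_stronglyMeasurable hXOm.comap_le ?_
        (integrable_indicator_one (N.measurable_V Y hT'm))
      rw [hpre]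
      exact (@stronglyMeasurable_const _ _ (MeasurableSpace.comap _ _) _ 1).indicator ⟨H, hHm, rfl⟩
    rw [h2] at h1
    filter_upwards [h1] with u hu
    have h3 : (N.condY X Y O (N.V X u, N.vec O u)) T'
        = ENNReal.ofReal (((N.condY X Y O (N.V X u, N.vec O u))).real T') := by
      have : IsProbabilityMeasure (N.condY X Y O (N.V X u, N.vec O u)) := by
        unfold SCM.condY; infer_instance
      rw [ofReal_measureReal]
    rw [h3]
    have h4 : ((N.condY X Y O (N.V X u, N.vec O u))).real T'
        = (N.V Y ⁻¹' T').indicator (fun _ => (1 : ℝ)) u := hu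
    rw [h4, hpre]
    by_cases hu' : (N.V X u, N.vec O u) ∈ H
    · simp [Set.indicator, hu']
    · simp [Set.indicator, hu']
  have hcond' := Measure.ae_ae_of_ae_prod (hac.ae_le hcond)
  -- The attained value of `X` is an atom of its law, so statements for almost every `x` hold at it.
  obtain ⟨x, hx, hxadj, hxcond⟩ : ∃ x, x = enc X (v ω₀ X) ∧
      N.doLaw X Y x = (N.lawO O).bind (fun o => N.condY X Y O (x, o)) ∧
      ∀ᵐ o ∂(N.lawO O), N.condY X Y O (x, o) T' = H.indicator 1 (x, o) := by
    refine ⟨_, rfl, ?_⟩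
    by_contra hcon
    have h1 := ae_iff.1 (hadj.and hcond')
    have h2 : N.lawX X {enc X (v ω₀ X)} = 0 :=
      measure_mono_null (Set.singleton_subset_iff.2 hcon) h1
    rw [SCM.lawX, Measure.map_apply (N.measurable_V X) (measurableSet_singleton _)] at h2
    have h3 : N.P {u | noise u ∈ ({ω₀} : Set (ι → B))} = 0 := by
      refine measure_mono_null (fun u hu => ?_) h2
      have hu' : noise u = ω₀ := hu
      simp only [Set.mem_preimage, Set.mem_singleton_iff, hV, hu']
    exact Set.singleton_ne_empty ω₀ (hnull _ h3)
  have hmeask : Measurable (fun o => N.condY X Y O (x, o)) :=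
    (N.condY X Y O).measurable.comp measurable_prodMk_left
  have e1 := congrArg (fun m => m T') hxadj
  rw [Measure.bind_apply hT'm hmeask.aemeasurable, lintegral_congr_ae hxcond] at e1
  have e2 : ∫⁻ o, H.indicator 1 (x, o) ∂(N.lawO O)
      = Q {ω | h (v ω₀ X) (fun j => v ω j)} := by
    have hHx : MeasurableSet (Prod.mk x ⁻¹' H : Set (N.Val O)) := measurable_prodMk_left hHm
    have : (fun o => H.indicator (1 : E (N.d X) × N.Val O → ℝ≥0∞) (x, o))
        = (Prod.mk x ⁻¹' H : Set (N.Val O)).indicator 1 := by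
      funext o
      by_cases ho : (x, o) ∈ H <;> simp [Set.indicator, ho]
    rw [this, lintegral_indicator_one hHx, SCM.lawO, Measure.map_apply (N.measurable_vec O) hHx,
      ← hPQ]
    congr 1
    ext u
    simp only [Set.mem_preimage, hH, Set.mem_ofPred_eq, hx, SCM.vec, hV]
    rw [hde]
    simp only [hde]
  have e3 : N.doLaw X Y x T' = Q {ω | vd (v ω₀ X) ω ∈ T} := by
    rw [SCM.doLaw, Measure.map_apply (N.measurable_eval _ _ Y) hT'm, ← hPQ]
    congr 1
    ext u
    simp only [Set.mem_preimage, Set.mem_ofPred_eq, hT']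
    rw [hdo (v ω₀ X) u, hde]
    exact (@Function.update_self _ (fun i => E (N.d i)) (fun _ _ => Classical.propDecidable _)
      X x 0).trans hx
  rw [← e3, e1, e2]

/-- Identifiability by adjustment, applied to a model that is given by structural equations `φ`
between variables with values in a finite type, with independent noise of law `μ`, where `v` and
`vd` are the solutions without and with an intervention on `X`. -/
theorem DAG.IdentifiableByAdjustment.finite {X Y : ι} {O : Set ι}
    (hid : G.IdentifiableByAdjustment X Y O) [Finite A] [MeasurableSingletonClass A] [Nonempty A]
    [Finite B] [MeasurableSingletonClass B] [Nonempty B]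
    {μ : Measure B} [IsProbabilityMeasure μ] (hμ : ∀ b, μ {b} ≠ 0)
    (φ : ∀ i, ({j // G.Adj j i} → A) → B → A) {v : (ι → B) → ι → A}
    (hv : ∀ ω i, v ω i = φ i (fun j => v ω j.1) (ω i)) {vd : A → (ι → B) → ι → A}
    (hvdX : ∀ x ω, vd x ω X = x)
    (hvd : ∀ x ω i, i ≠ X → vd x ω i = φ i (fun j => vd x ω j.1) (ω i))
    (T : Set A) (h : A → (O → A) → Prop)
    (hT : ∀ ω, v ω Y ∈ T ↔ h (v ω X) (fun j => v ω j))
    (hpos : ∀ ω ω', ∃ ω'', v ω'' X = v ω X ∧ ∀ j ∈ O, v ω'' j = v ω' j) (ω₀ : ι → B) :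
    (Measure.pi fun _ : ι => μ) {ω | vd (v ω₀ X) ω Y ∈ T}
      = (Measure.pi fun _ : ι => μ) {ω | h (v ω₀ X) (fun j => v ω j)} := by
  obtain ⟨enc, dec, henc, hdec, hde⟩ := exists_encoding A
  obtain ⟨g, hg, hgμ⟩ := exists_map_unitRange μ
  have hmapP := SCM.ofFinite_map_P (φ := φ) henc hdec hg hgμ
  have hgm : Measurable (fun (u : (SCM.ofFinite φ henc hdec hg).Ω) (i : ι) => g (u i)) :=
    measurable_pi_lambda _ fun i => hg.comp (measurable_pi_apply i)
  refine hid.measure_eq (N := SCM.ofFinite φ henc hdec hg) (enc := fun _ => enc)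
    (dec := fun _ => dec) (fun _ => hdec) (fun _ => hde) (noise := fun u i => g (u i)) (v := v)
    (vd := fun x ω => vd x ω Y) (fun S => ?_) (fun ω => ?_)
    (fun i u => SCM.ofFinite_V henc hdec hg hde hv u i)
    (fun x u b hb => SCM.ofFinite_eval henc hdec hg hde (hvdX x) (hvd x) hb u Y) T h hT hpos ω₀
  · rw [← hmapP, Measure.map_apply hgm (Set.toFinite S).measurableSet]
    rfl
  · rw [Measure.pi_singleton]
    exact Finset.prod_ne_zero_iff.2 fun i _ => hμ _

end FiniteModel

/-- There are biased coins. -/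
theorem exists_biased_coin : ∃ β : Measure (ZMod 2), IsProbabilityMeasure β ∧ (∀ b, β {b} ≠ 0) ∧
    β {1} ≠ β {0} := by
  have e0 : ((4⁻¹ : ℝ≥0∞) • Measure.dirac (0 : ZMod 2) + (3 * 4⁻¹ : ℝ≥0∞) • Measure.dirac 1 :
      Measure (ZMod 2)) {0} = 4⁻¹ := by
    simp
  have e1 : ((4⁻¹ : ℝ≥0∞) • Measure.dirac (0 : ZMod 2) + (3 * 4⁻¹ : ℝ≥0∞) • Measure.dirac 1 :
      Measure (ZMod 2)) {1} = 3 * 4⁻¹ := by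
    simp
  refine ⟨(4⁻¹ : ℝ≥0∞) • Measure.dirac 0 + (3 * 4⁻¹ : ℝ≥0∞) • Measure.dirac 1, ⟨?_⟩, ?_, ?_⟩
  · simp only [Measure.coe_add, Measure.coe_smul, Pi.add_apply, Pi.smul_apply, measure_univ,
      smul_eq_mul, mul_one]
    have h4 : (4⁻¹ : ℝ≥0∞) + 3 * 4⁻¹ = 4 * 4⁻¹ := by ring
    rw [h4]
    exact ENNReal.mul_inv_cancel (by norm_num) (by norm_num)
  · intro b
    fin_cases b
    · exact e0.trans_ne (by simp)
    · exact e1.trans_ne (by simp)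
  · rw [e0, e1]
    intro h
    have := congrArg ENNReal.toReal h
    norm_num at this

/-- The sum telescopes: each interior term occurs twice and cancels modulo 2. -/
theorem sum_add_succ_of_charTwo {k : ℕ} (c : Fin (k + 1) → ZMod 2) :
    ∑ a : Fin k, (c a.castSucc + c a.succ) = c 0 + c (Fin.last k) := by
  induction k with
  | zero => simpa using (CharTwo.add_self_eq_zero (c 0)).symm
  | succ k ih =>
    rw [Fin.sum_univ_castSucc]
    have := ih (fun a => c a.castSucc)
    simp only [← Fin.succ_castSucc] at this
    rw [this, Fin.succ_last, Fin.castSucc_zero]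
    generalize c 0 = x, c (Fin.last k).castSucc = y, c (Fin.last (k + 1)) = z
    revert x y z
    decide

/-! ### Passing a bit along directed paths. -/

section Flow

variable {ι : Type} {G : DAG ι}

/-- A directed path follows another one up to its first node outside `A`. -/
theorem DAG.Reach.inter_or_exit {A A' : Set ι} {i j : ι} (h : G.Reach A' i j) :
    G.Reach (A ∩ A') i j ∨
      ∃ w z, G.Reach (A ∩ A') i w ∧ G.Adj w z ∧ z ∈ A' ∧ z ∉ A ∧ G.Reach A' z j := by
  induction h with
  | refl => exact Or.inl .refl
  | @tail b c _ hbc ih =>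
    rcases ih with ih | ⟨w, z, h1, h2, h3, h4, h5⟩
    · by_cases hc : c ∈ A
      · exact Or.inl (ih.tail ⟨hbc.1, hc, hbc.2⟩)
      · exact Or.inr ⟨b, c, ih, hbc.1, hbc.2, hc, .refl⟩
    · exact Or.inr ⟨w, z, h1, h2, h3, h4, h5.tail hbc⟩

theorem DAG.reach_univ {i j : ι} (h : Relation.ReflTransGen G.Adj i j) : G.Reach Set.univ i j :=
  Relation.ReflTransGen.mono (fun _ _ h => ⟨h, trivial⟩) _ _ h

open Classical in
/-- The structural equation at the node `i` that passes on the value of the node `s` along the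
directed paths in `A`. -/
noncomputable def DAG.flow (G : DAG ι) (A : Set ι) (s i : ι) (own : ZMod 2)
    (pa : {j // G.Adj j i} → ZMod 2) : ZMod 2 :=
  if i = s then own
  else if h : G.Reach A s i ∧ ∃ j : {j // G.Adj j i}, G.Reach A s j.1 then pa h.2.choose else 0

-- All reached parents carry the same bit, so it is irrelevant which of them is chosen, and a
-- reached node other than `s` has a reached parent.
open Classical in
theorem DAG.flow_eq {A : Set ι} {s i : ι} {own : ZMod 2} {pa : {j // G.Adj j i} → ZMod 2}
    {c : ZMod 2} (hown : i = s → own = c)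
    (hpa : ∀ j : {j // G.Adj j i}, G.Reach A s j.1 → pa j = c) :
    G.flow A s i own pa = if G.Reach A s i then c else 0 := by
  unfold DAG.flow
  by_cases hi : i = s
  · subst hi
    rw [if_pos rfl, if_pos .refl, hown rfl]
  · rw [if_neg hi]
    by_cases hr : G.Reach A s i
    · rw [if_pos hr]
      rcases Relation.ReflTransGen.cases_tail hr with h | ⟨j, hj, hji⟩
      · exact absurd h hi
      · have h : G.Reach A s i ∧ ∃ j : {j // G.Adj j i}, G.Reach A s j.1 := ⟨hr, ⟨j, hji.1⟩, hj⟩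
        rw [dif_pos h]
        exact hpa _ h.2.choose_spec
    · rw [if_neg hr, dif_neg fun h => hr h.1]

end Flow

/-! ### Models that violate the adjustment formula. -/

section Completeness

variable {ι : Type} [Fintype ι] {G : DAG ι}

/-- Adjustment for a mediator is not valid. -/
theorem DAG.not_identifiable_of_mediator {X Y w Z : ι} {O : Set ι} (hXO : X ∉ O)
    (hw : G.Reach Oᶜ X w) (hwZ : G.Adj w Z) (hZO : Z ∈ O)
    (hZY : Relation.ReflTransGen G.Adj Z Y) : ¬ G.IdentifiableByAdjustment X Y O := by
  classical
  intro hid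
  obtain ⟨β, _, hβ, hβ'⟩ := exists_biased_coin
  have hXZ : X ≠ Z := fun h => hXO (h ▸ hZO)
  have hXR : ¬ G.Reach Set.univ Z X := fun h =>
    G.acyclic Z (Relation.TransGen.tail' (h.reflTransGen.trans hw.reflTransGen) hwZ)
  have hYR : G.Reach Set.univ Z Y := reach_univ hZY
  have hXY : X ≠ Y := fun h => hXR (h ▸ hYR)
  have hOR : ∀ i ∈ O, ¬ G.Reach Oᶜ X i := fun i hi h => h.mem hXO hi
  -- The first bit is the noise of `X`, carried along unobserved nodes as far as `w`. At `Z` it is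
  -- added to the noise of `Z`, and the sum is the second bit, carried on to `Y`.
  set φ : ∀ i, ({j // G.Adj j i} → ZMod 2 × ZMod 2) → ZMod 2 → ZMod 2 × ZMod 2 := fun i pa b =>
    (G.flow Oᶜ X i b (fun j => (pa j).1),
      G.flow Set.univ Z i (b + if h : G.Adj w i then (pa ⟨w, h⟩).1 else 0) (fun j => (pa j).2))
    with hφ
  set v : (ι → ZMod 2) → ι → ZMod 2 × ZMod 2 := fun ω i =>
    (if G.Reach Oᶜ X i then ω X else 0, if G.Reach Set.univ Z i then ω Z + ω X else 0) with hv
  set vd : ZMod 2 × ZMod 2 → (ι → ZMod 2) → ι → ZMod 2 × ZMod 2 := fun x ω i =>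
    if i = X then x else
    (if G.Reach Oᶜ X i then x.1 else 0, if G.Reach Set.univ Z i then ω Z + x.1 else 0) with hvd
  have key := hid.finite hβ φ (v := v) (vd := vd) ?_ ?_ ?_ {a | a.2 = 1}
    (fun _ o => (o ⟨Z, hZO⟩).2 = 1) ?_ ?_
  -- The bit of `Y` can be read off at `Z`, so the adjusted probability does not depend on `x`;
  -- under the intervention the bit is `ω Z + x`. Comparing `x = 0` with `x = 1` makes the coin
  -- fair.
  · have h0 := key 0
    have h1 := key 1
    have hY0 : ∀ ω, (vd (v 0 X) ω Y).2 = ω Z := fun ω => by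
      simp [hvd, hv, hXY.symm, hYR]
    have hY1 : ∀ ω, (vd (v 1 X) ω Y).2 = ω Z + 1 := fun ω => by
      simp [hvd, hv, hXY.symm, hYR, show G.Reach Oᶜ X X from .refl]
    simp only [Set.mem_ofPred_eq, hY0, hY1] at h0 h1
    have h2 : ∀ b : ZMod 2, (Measure.pi fun _ : ι => β) {ω | ω Z = b} = β {b} := fun b =>
      (measurePreserving_eval (fun _ : ι => β) Z).measure_preimage
        (measurableSet_singleton b).nullMeasurableSet
    have h3 : {ω : ι → ZMod 2 | ω Z + 1 = 1} = {ω | ω Z = 0} := by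
      ext ω
      simp
    rw [h3] at h1
    exact hβ' ((h2 1).symm.trans (h0.trans (h1.symm.trans (h2 0))))
  · intro ω i
    refine Prod.ext ?_ ?_
    · simp only [hφ, hv]
      exact (flow_eq (fun h => by rw [h]) fun j hj => by simp [hj]).symm
    · simp only [hφ, hv]
      refine (flow_eq (fun h => ?_) fun j hj => ?_).symm
      · subst h
        rw [dif_pos hwZ]
        simp [hw]
      · simp [hj]
  · intro x ω
    simp [hvd]
  · intro x ω i hi
    refine Prod.ext ?_ ?_
    · have := flow_eq (A := Oᶜ) (s := X) (i := i) (own := ω i)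
        (pa := fun j => (vd x ω j).1) (c := x.1) (fun h => absurd h hi)
        (fun j (hj : G.Reach Oᶜ X j.1) => by
          by_cases hjX : j.1 = X <;> simp [hvd, hj, hjX])
      simp only [hφ]
      rw [this]
      simp [hvd, hi]
    · have := flow_eq (A := Set.univ) (s := Z) (i := i)
        (own := ω i + if h : G.Adj w i then (vd x ω w).1 else 0)
        (pa := fun j => (vd x ω j).2) (c := ω Z + x.1) (fun h => by
          subst h
          rw [dif_pos hwZ]
          by_cases hwX : w = X <;> simp [hvd, hw, hwX]) (fun j (hj : G.Reach Set.univ Z j.1) => by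
          have hjX : j.1 ≠ X := fun h => hXR (h ▸ hj)
          simp [hvd, hj, hjX])
      simp only [hφ]
      rw [this]
      simp [hvd, hi]
  · intro ω
    simp [hv, hYR, show G.Reach Set.univ Z Z from .refl]
  · intro ω ω'
    -- The noise at `Z` compensates for the change of the noise at `X`, so all observed values stay
    -- as they were.
    refine ⟨Function.update (Function.update ω' Z (ω' Z + ω' X + ω X)) X (ω X), ?_, ?_⟩
    · simp [hv, hXR]
    · intro i hi
      simp only [hv, if_neg (hOR i hi), Function.update_self, Function.update_of_ne hXZ.symm]
      have : ω' Z + ω' X + ω X + ω X = ω' Z + ω' X := by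
        rw [add_assoc, CharTwo.add_self_eq_zero, add_zero]
      rw [this]

/-- Adjustment is not valid if there is an open back-door path. -/
theorem DAG.not_identifiable_of_chain {X Y : ι} {O : Set ι} {k : ℕ} (s : Fin (k + 1) → ι)
    (j Z : Fin k → ι) (hs0 : G.Reach Oᶜ (s 0) X) (hsO : ∀ a, s a ∉ O)
    (hsX : ∀ a : Fin k, s a.succ ≠ X)
    (hsj : ∀ a : Fin k, s a.castSucc = j a ∨ G.Adj (s a.castSucc) (j a))
    (hsj' : ∀ a : Fin k, s a.succ = j a ∨ G.Adj (s a.succ) (j a))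
    (hjX : ∀ a, j a ≠ X) (hjZ : ∀ a, G.Reach {X}ᶜ (j a) (Z a)) (hZO : ∀ a, Z a ∈ O)
    (hlast : s (Fin.last k) ≠ X) (hY : G.Reach ({X} ∪ O)ᶜ (s (Fin.last k)) Y) :
    ¬ G.IdentifiableByAdjustment X Y O := by
  classical
  intro hid
  obtain ⟨β, _, hβ, hβ'⟩ := exists_biased_coin
  have hlast' : s (Fin.last k) ∈ ({X} ∪ O)ᶜ := by simp [hlast, hsO]
  have hXY : ¬ G.Reach ({X} ∪ O)ᶜ (s (Fin.last k)) X := fun h => h.mem hlast' (by simp)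
  have hXj : ∀ a, ¬ G.Reach {X}ᶜ (j a) X := fun a h => h.mem (hjX a) (by simp)
  have hYX : Y ≠ X := by
    rintro rfl
    exact hXY hY
  -- Source `s a` holds a bit `c a`, available to itself and its children. The four components of a
  -- value are: `c 0` on its way to `X`, the last bit on its way to `Y`, the bits of the sources,
  -- and for each collider `j a` the sum `c a + c (a + 1)` on its way to `Z a`. These routes keep
  -- the observed nodes ignorant of all but the sums.
  set fetch : Fin (k + 1) → ∀ i, ({p // G.Adj p i} →
      ZMod 2 × ZMod 2 × (Fin (k + 1) → ZMod 2) × (Fin k → ZMod 2)) → (Fin (k + 1) → ZMod 2) →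
      ZMod 2 := fun a i pa b =>
    if i = s a then b a else if h : G.Adj (s a) i then (pa ⟨s a, h⟩).2.2.1 a else 0 with hfetch
  set φ : ∀ i, ({p // G.Adj p i} →
      ZMod 2 × ZMod 2 × (Fin (k + 1) → ZMod 2) × (Fin k → ZMod 2)) → (Fin (k + 1) → ZMod 2) →
      ZMod 2 × ZMod 2 × (Fin (k + 1) → ZMod 2) × (Fin k → ZMod 2) := fun i pa b =>
    (G.flow Oᶜ (s 0) i (b 0) (fun p => (pa p).1),
      G.flow ({X} ∪ O)ᶜ (s (Fin.last k)) i (b (Fin.last k)) (fun p => (pa p).2.1),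
      fun a => if i = s a then b a else 0,
      fun a => G.flow {X}ᶜ (j a) i (fetch a.castSucc i pa b + fetch a.succ i pa b)
        (fun p => (pa p).2.2.2 a)) with hφ
  set v : (ι → Fin (k + 1) → ZMod 2) → ι →
      ZMod 2 × ZMod 2 × (Fin (k + 1) → ZMod 2) × (Fin k → ZMod 2) := fun ω i =>
    (if G.Reach Oᶜ (s 0) i then ω (s 0) 0 else 0,
      if G.Reach ({X} ∪ O)ᶜ (s (Fin.last k)) i then ω (s (Fin.last k)) (Fin.last k) else 0,
      fun a => if i = s a then ω i a else 0,
      fun a => if G.Reach {X}ᶜ (j a) i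
        then ω (s a.castSucc) a.castSucc + ω (s a.succ) a.succ else 0) with hv
  -- If `s 0 = X`, the intervention may affect the collider sums; since only the second component of
  -- `Y` is needed, no closed form of the solution is required.
  choose vd hvd using fun x (ω : ι → Fin (k + 1) → ZMod 2) =>
    G.exists_solution (fun i pa => if i = X then x else φ i pa (ω i))
  have hvdY : ∀ x ω i, G.Reach ({X} ∪ O)ᶜ (s (Fin.last k)) i →
      (vd x ω i).2.1 = ω (s (Fin.last k)) (Fin.last k) := by
    intro x ω i
    induction i using G.wf.induction with
    | _ i ih =>
      intro hi
      have hiX : i ≠ X := by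
        rintro rfl
        exact hXY hi
      rw [hvd, if_neg hiX]
      exact (flow_eq (fun h => by rw [h]) fun p hp => ih p.1 p.2 hp).trans (if_pos hi)
  have hfetch' : ∀ a i ω, (s a = i ∨ G.Adj (s a) i) →
      fetch a i (fun p => v ω p.1) (ω i) = ω (s a) a := by
    intro a i ω h
    by_cases hi : i = s a
    · simp [hfetch, hi]
    · rw [hfetch]
      simp only [if_neg hi, dif_pos (h.resolve_left (Ne.symm hi))]
      simp [hv]
  have key := hid.finite (A := ZMod 2 × ZMod 2 × (Fin (k + 1) → ZMod 2) × (Fin k → ZMod 2))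
    (B := Fin (k + 1) → ZMod 2) (μ := Measure.pi fun _ => β) (fun b => ?_) φ (v := v) (vd := vd)
    ?_ (fun x ω => by rw [hvd, if_pos rfl]) (fun x ω i hi => by rw [hvd, if_neg hi])
    {a | a.2.1 = 1} (fun x o => x.1 + ∑ a, (o ⟨Z a, hZO a⟩).2.2.2 a = 1) ?_ ?_
  · have h0 := key 0
    have h1 := key 1
    simp only [Set.mem_ofPred_eq, hvdY _ _ Y hY] at h0 h1
    set Q := Measure.pi fun _ : ι => Measure.pi fun _ : Fin (k + 1) => β with hQ
    have hsum : ∀ ω, ∑ a, (v ω (Z a)).2.2.2 a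
        = ω (s 0) 0 + ω (s (Fin.last k)) (Fin.last k) := by
      intro ω
      rw [← sum_add_succ_of_charTwo (fun a => ω (s a) a)]
      exact Finset.sum_congr rfl fun a _ => by simp [hv, hjZ a]
    have hc : ∀ b : ZMod 2, Q {ω | ω (s (Fin.last k)) (Fin.last k) = b} = β {b} := fun b =>
      ((measurePreserving_eval (fun _ => β) (Fin.last k)).comp
        (measurePreserving_eval (fun _ : ι => Measure.pi fun _ : Fin (k + 1) => β)
          (s (Fin.last k)))).measure_preimage (measurableSet_singleton b).nullMeasurableSet
    have hx0 : (v 0 X).1 = 0 := by simp [hv]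
    have hx1 : (v 1 X).1 = 1 := by simp [hv, hs0]
    simp only [hsum, hx0, hx1, hc] at h0 h1
    -- The observed sums telescope to `c 0 + c k`, so adjustment predicts the probability of `x + c
    -- 0 + c k = 1`. Its values at `x = 0` and `x = 1` add up to one, while the intervention yields
    -- `β {1}` in both cases.
    have hcompl : {ω : ι → Fin (k + 1) → ZMod 2 |
          1 + (ω (s 0) 0 + ω (s (Fin.last k)) (Fin.last k)) = 1}
        = {ω | 0 + (ω (s 0) 0 + ω (s (Fin.last k)) (Fin.last k)) = 1}ᶜ := by
      ext ω
      simp only [Set.mem_compl_iff, Set.mem_ofPred_eq]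
      generalize ω (s 0) 0 + ω (s (Fin.last k)) (Fin.last k) = e
      revert e
      decide
    have hcompl' : {ω : ι → Fin (k + 1) → ZMod 2 | ω (s (Fin.last k)) (Fin.last k) = 0}
        = {ω | ω (s (Fin.last k)) (Fin.last k) = 1}ᶜ := by
      ext ω
      simp only [Set.mem_compl_iff, Set.mem_ofPred_eq]
      generalize ω (s (Fin.last k)) (Fin.last k) = e
      revert e
      decide
    refine hβ' ?_
    have h2 := hc 0
    rw [hcompl', prob_compl_eq_one_sub (Set.toFinite _).measurableSet, hc] at h2
    rw [hcompl, prob_compl_eq_one_sub (Set.toFinite _).measurableSet, ← h0] at h1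
    exact h1.trans h2
  · rw [Measure.pi_singleton]
    exact Finset.prod_ne_zero_iff.2 fun i _ => hβ _
  · intro ω i
    refine Prod.ext ?_ (Prod.ext ?_ (Prod.ext ?_ ?_))
    · simp only [hφ, hv]
      exact (flow_eq (fun h => by rw [h]) fun p hp => by simp [hp]).symm
    · simp only [hφ, hv]
      exact (flow_eq (fun h => by rw [h]) fun p hp => by simp only [if_pos hp]).symm
    · rfl
    · funext a
      change _ = G.flow {X}ᶜ (j a) i (fetch a.castSucc i (fun p => v ω p.1) (ω i)
        + fetch a.succ i (fun p => v ω p.1) (ω i)) (fun p => (v ω p.1).2.2.2 a)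
      refine (flow_eq (fun h => ?_) fun p hp => ?_).symm
      · subst h
        rw [hfetch' _ _ _ (hsj a), hfetch' _ _ _ (hsj' a)]
      · simp only [hv, if_pos hp]
  · intro ω
    have : ∑ a, (v ω (Z a)).2.2.2 a = ω (s 0) 0 + ω (s (Fin.last k)) (Fin.last k) := by
      rw [← sum_add_succ_of_charTwo (fun a => ω (s a) a)]
      exact Finset.sum_congr rfl fun a _ => by simp [hv, hjZ a]
    rw [this]
    simp only [Set.mem_ofPred_eq, hv, if_pos hs0, if_pos hY, ← add_assoc,
      CharTwo.add_self_eq_zero, zero_add]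
  · intro ω ω'
    -- Adding the same bit to all the noise changes `c 0` as desired and cancels in every collider
    -- sum.
    refine ⟨fun i a => ω' i a + (ω (s 0) 0 + ω' (s 0) 0), ?_, ?_⟩
    · have h0 : ω' (s 0) 0 + (ω (s 0) 0 + ω' (s 0) 0) = ω (s 0) 0 := by
        generalize ω' (s 0) 0 = x, ω (s 0) 0 = y
        revert x y
        decide
      refine Prod.ext ?_ (Prod.ext ?_ (Prod.ext ?_ ?_))
      · simp only [hv, h0]
      · simp only [hv, if_neg hXY]
      · funext a
        refine Fin.cases ?_ (fun a => ?_) a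
        · by_cases hX : X = s 0
          · simp only [hv, if_pos hX]
            rw [hX, h0]
          · simp only [hv, if_neg hX]
        · simp only [hv, if_neg (hsX a).symm]
      · funext a
        simp only [hv, if_neg (hXj a)]
    · intro i hi
      refine Prod.ext ?_ (Prod.ext ?_ (Prod.ext ?_ ?_))
      · simp only [hv, if_neg fun h : G.Reach Oᶜ (s 0) i => h.mem (hsO 0) hi]
      · simp only [hv, if_neg fun h : G.Reach ({X} ∪ O)ᶜ (s (Fin.last k)) i =>
          h.mem hlast' (Or.inr hi)]
      · funext a
        have : i ≠ s a := fun h => hsO a (h ▸ hi)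
        simp only [hv, if_neg this]
      · funext a
        simp only [hv]
        congr 1
        generalize ω' (s a.castSucc) a.castSucc = x, ω' (s a.succ) a.succ = y,
          ω (s 0) 0 + ω' (s 0) 0 = d
        revert x y d
        decide

end Completeness

/-! ### From identifiability to separation in the moral graph. -/

section Separation

variable {ι : Type} {G : DAG ι}

/-- `k` is a common child of `s` and `t`, where a node counts as its own child. -/
def DAG.CommonChild (G : DAG ι) (k s t : ι) : Prop :=
  (s = k ∨ G.Adj s k) ∧ (t = k ∨ G.Adj t k)

/-- A path in the moral graph between `X` and `t` can be turned into a sequence of colliders with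
observed descendants, preceded by a directed path to `X`. -/
theorem DAG.exists_chain_of_moral {X : ι} {O : Set ι} (hXO : X ∉ O) {t : ι}
    (ht : Relation.ReflTransGen (fun s t => s ∉ O ∧ t ∉ O ∧
      ∃ k, (∃ z ∈ {X} ∪ O, Relation.ReflTransGen G.Adj k z) ∧ G.CommonChild k s t) X t) :
    ∃ (k : ℕ) (s j Z : ℕ → ι), s k = t ∧ G.Reach Oᶜ (s 0) X ∧ (∀ a ≤ k, s a ∉ O) ∧
      (∀ a < k, s (a + 1) ≠ X) ∧ ∀ a < k, G.CommonChild (j a) (s a) (s (a + 1)) ∧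
        j a ≠ X ∧ G.Reach {X}ᶜ (j a) (Z a) ∧ Z a ∈ O := by
  classical
  induction ht with
  | refl =>
    exact ⟨0, fun _ => X, fun _ => X, fun _ => X, rfl, .refl, fun _ _ => hXO, by simp, by simp⟩
  | @tail t t' _ htt' ih =>
    obtain ⟨-, ht', i, ⟨z, hz, hiz⟩, hit, hit'⟩ := htt'
    -- If the common child `i` leads to `X` through unobserved nodes, then so does `t'`, and the
    -- chain restarts at `t'` with length zero. It also restarts if `t'` is `X`; this keeps all
    -- later sources different from `X`.
    by_cases hX : i ∉ O ∧ G.Reach Oᶜ i X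
    · refine ⟨0, fun _ => t', fun _ => X, fun _ => X, rfl, ?_, fun _ _ => ht', by simp, by simp⟩
      rcases hit' with rfl | hit'
      · exact hX.2
      · exact Relation.ReflTransGen.head ⟨hit', hX.1⟩ hX.2
    by_cases htX : t' = X
    · subst htX
      exact ⟨0, fun _ => t', fun _ => t', fun _ => t', rfl, .refl, fun _ _ => hXO, by simp,
        by simp⟩
    have hiX : i ≠ X := by
      rintro rfl
      exact hX ⟨hXO, .refl⟩
    -- On a path from `i` into `{X} ∪ O` the first node of that set cannot be `X`, by the case just
    -- excluded; so it is observed and reached without passing `X`.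
    obtain ⟨Z₀, hiZ, hZO⟩ : ∃ Z₀, G.Reach {X}ᶜ i Z₀ ∧ Z₀ ∈ O := by
      by_cases hiO : i ∈ O
      · exact ⟨i, .refl, hiO⟩
      have hi : i ∈ ({X} ∪ O)ᶜ := by simp [hiX, hiO]
      rcases (reach_univ hiz).inter_or_exit (A := ({X} ∪ O)ᶜ) with h | ⟨w, z', h1, h2, -, h3, -⟩
      · rw [Set.inter_univ] at h
        exact absurd hz (h.mem hi)
      rw [Set.inter_univ] at h1
      rw [Set.notMem_compl_iff] at h3
      by_cases hz'X : z' = X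
      · subst hz'X
        exact absurd ⟨hiO, (h1.mono (Set.compl_subset_compl.2 Set.subset_union_right)).tail
          ⟨h2, hXO⟩⟩ hX
      · exact ⟨z', (h1.mono (Set.compl_subset_compl.2 Set.subset_union_left)).tail ⟨h2, hz'X⟩,
          h3.resolve_left hz'X⟩
    obtain ⟨k, s, j, Z, rfl, h0, hO, hsX, hch⟩ := ih
    refine ⟨k + 1, Function.update s (k + 1) t', Function.update j k i, Function.update Z k Z₀,
      by simp, ?_, ?_, ?_, ?_⟩
    · rwa [Function.update_of_ne (by omega)]
    · intro a ha
      rcases Nat.le_succ_iff.1 ha with h | rfl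
      · rw [Function.update_of_ne (by omega)]
        exact hO a h
      · rwa [Function.update_self]
    · intro a ha
      rcases Nat.lt_succ_iff_lt_or_eq.1 ha with h | rfl
      · rw [Function.update_of_ne (by omega)]
        exact hsX a h
      · rwa [Function.update_self]
    · intro a ha
      rw [Function.update_of_ne (show a ≠ k + 1 by omega)]
      rcases Nat.lt_succ_iff_lt_or_eq.1 ha with h | rfl
      · rw [Function.update_of_ne (show a + 1 ≠ k + 1 by omega), Function.update_of_ne h.ne,
          Function.update_of_ne h.ne]
        exact hch a h
      · simp only [Function.update_self]
        exact ⟨⟨hit, hit'⟩, hiX, hiZ, hZO⟩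

/-- If the causal effect is identifiable by adjustment, then the exogenous variables that matter for
the outcome when `X` and the observed non-descendants of `X` are set are separated from `X` by the
covariates. -/
theorem DAG.IdentifiableByAdjustment.exists_separation [Fintype ι] {X Y : ι} {O : Set ι}
    (hid : G.IdentifiableByAdjustment X Y O) (hXO : X ∉ O) :
    ∃ W S J : Set ι, (∀ k ∈ W, ∀ j, G.Adj j k → j ∈ W) ∧ O ⊆ W ∧
      (∀ k ∈ W, k ∈ J → ∀ s, s = k ∨ G.Adj s k → s ∉ O → s ∈ S) ∧
      (∀ k ∈ W, k ∉ J → ∀ s, s = k ∨ G.Adj s k → s ∉ O → s ∉ S) ∧ X ∈ W ∧ X ∈ S ∧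
      Disjoint (G.activeSet Y ({X} ∪ G.nonDesc X O)) J := by
  -- `W` is the ancestral closure of `{X} ∪ O`, and `S` is the component of `X` in its moral graph
  -- with `O` removed. `J` is chosen to consist of the nodes of `W` whose family meets this
  -- component, so each family is on one side.
  set W : Set ι := {k | ∃ z ∈ {X} ∪ O, Relation.ReflTransGen G.Adj k z} with hW
  set S : Set ι := {t | Relation.ReflTransGen (fun s t => s ∉ O ∧ t ∉ O ∧
    ∃ k, (∃ z ∈ {X} ∪ O, Relation.ReflTransGen G.Adj k z) ∧ G.CommonChild k s t) X t} with hS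
  refine ⟨W, S, {k ∈ W | ∃ s ∈ S, s ∉ O ∧ (s = k ∨ G.Adj s k)}, ?_, ?_, ?_, ?_, ?_, .refl, ?_⟩
  · rintro k ⟨z, hz, hkz⟩ j hj
    exact ⟨z, hz, hkz.head hj⟩
  · exact fun k hk => ⟨k, Or.inr hk, .refl⟩
  · rintro k hkW ⟨-, t, htS, htO, htk⟩ s hs hsO
    exact Relation.ReflTransGen.tail htS ⟨htO, hsO, k, hkW, htk, hs⟩
  · exact fun k hkW hk s hs hsO hsS => hk ⟨hkW, s, hsS, hsO, hs⟩
  · exact ⟨X, Or.inl rfl, .refl⟩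
  rw [Set.disjoint_left]
  rintro i ⟨hiB, hiY⟩ ⟨hiW, t, htS, htO, hti⟩
  -- The first observed node on a directed path from `X` to such a `z` is a mediator, as it is still
  -- an ancestor of `Y`.
  have hmed : ∀ z ∈ O, z ∉ G.nonDesc X O → Relation.ReflTransGen G.Adj z Y → False := by
    intro z hzO hz hzY
    have hXz : G.IsDesc X z := by
      by_contra h
      exact hz ⟨hzO, h⟩
    rcases (reach_univ hXz.to_reflTransGen).inter_or_exit (A := Oᶜ)
      with h | ⟨w, z', h1, h2, -, h3, h4⟩
    · rw [Set.inter_univ] at h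
      exact h.mem hXO hzO
    · rw [Set.inter_univ] at h1
      exact not_identifiable_of_mediator hXO h1 h2 (Set.notMem_compl_iff.1 h3)
        (h4.reflTransGen.trans hzY) hid
  have hiX : i ≠ X := fun h => hiB (Or.inl h)
  by_cases hiO : i ∈ O
  · exact hmed i hiO (fun h => hiB (Or.inr h)) hiY.reflTransGen
  -- If the path from `i` to `Y` avoids `O`, it completes a chain from `X`. Otherwise it enters `O`
  -- outside the observed non-descendants, hence at a mediator.
  rcases hiY.inter_or_exit (A := Oᶜ) with h | ⟨w, z, -, -, h2, h3, h4⟩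
  · have hiS : i ∈ S :=
      Relation.ReflTransGen.tail htS ⟨htO, hiO, i, hiW, hti, Or.inl rfl⟩
    obtain ⟨k, s, j, Z, rfl, h0, hO, hsX, hch⟩ := exists_chain_of_moral hXO hiS
    refine not_identifiable_of_chain (k := k) (fun a => s a) (fun a => j a) (fun a => Z a)
      (by simpa using h0) (fun a => hO a (by omega)) (fun a => by simpa using hsX a a.2)
      (fun a => by simpa using (hch a a.2).1.1) (fun a => by simpa using (hch a a.2).1.2)
      (fun a => (hch a a.2).2.1) (fun a => (hch a a.2).2.2.1) (fun a => (hch a a.2).2.2.2)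
      (by simpa using hiX) ?_ hid
    simp only [Fin.val_last]
    refine h.mono ?_
    rintro x ⟨hx1, hx2⟩ (hx | hx)
    · exact hx2 (Or.inl hx)
    · exact hx1 hx
  · exact hmed z (Set.notMem_compl_iff.1 h3) (fun h => h2 (Or.inr h)) h4.reflTransGen

end Separation

end CausalBias

/-! ### Decomposition and vanishing of the bias. -/

open CausalBias MeasureTheory ProbabilityTheory Topology in
theorem proposition1 {ι : Type} [Fintype ι] (G : DAG ι) (M : SCM G) (hfaith : M.Faithful)
    -- treatment, outcome and observed covariates
    (X Y : ι) (O : Set ι) (hXY : X ≠ Y) (hXO : X ∉ O) (hYO : Y ∉ O)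
    -- the causal exogenous set, with or without the noise of the treatment
    (K : Set ι) (hK₁ : M.causalSet X Y O \ {X} ⊆ K) (hK₂ : K ⊆ M.causalSet X Y O)
    -- given `o`, the treatment values considered: an open part of the support of `X` given `o`
    (D : M.Val O → Set (E (M.d X)))
    (hDopen : ∀ᵐ o ∂(M.lawO O), IsOpen (D o))
    (hDsupp : ∀ᵐ o ∂(M.lawO O), D o ⊆ (M.condX X O o).support)
    -- the regression function, in a version that is continuous in `x`
    (r : E (M.d X) → M.Val O → E (M.d Y))
    (hr : ∀ᵐ z ∂(M.lawXO X O), r z.1 z.2 = ∫ y, y ∂(M.condY X Y O z))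
    (hrcont : ∀ᵐ o ∂(M.lawO O), ContinuousOn (fun x => r x o) (D o))
    -- the conditional density of the causal exogenous variables given `x` and `o`
    (ν : M.Val O → Measure (M.ExoVal K)) (hν : ∀ o, SigmaFinite (ν o))
    (p : E (M.d X) → M.Val O → M.ExoVal K → ℝ)
    (hpmeas : ∀ x o, Measurable (p x o))
    (hpnonneg : ∀ x o c, 0 ≤ p x o c)
    (hptotal : ∀ᵐ o ∂(M.lawO O), ∀ x ∈ D o, IsProbabilityMeasure (densLaw (ν o) (p x o)))
    (hp : ∀ᵐ z ∂(M.lawXO X O), M.condU X O K z = densLaw (ν z.2) (p z.1 z.2))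
    -- differentiability with respect to the treatment
    (hfdiff : ∀ᵐ o ∂(M.lawO O), ∀ᵐ c ∂(ν o), ∀ x ∈ D o,
      DifferentiableAt ℝ (fun x' => M.fYOn X Y O K x' o c) x)
    (hpdiff : ∀ᵐ o ∂(M.lawO O), ∀ᵐ c ∂(ν o), ∀ x ∈ D o,
      DifferentiableAt ℝ (fun x' => p x' o c) x)
    -- regularity: integrability, and local domination of the derivative of `p • f_Y`
    (hfint : ∀ᵐ o ∂(M.lawO O), ∀ x ∈ D o,
      Integrable (fun c => M.fYOn X Y O K x o c) (densLaw (ν o) (p x o)))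
    (hdfint : ∀ᵐ o ∂(M.lawO O), ∀ x ∈ D o,
      Integrable (fun c => fderiv ℝ (fun x' => M.fYOn X Y O K x' o c) x) (densLaw (ν o) (p x o)))
    (hdom : ∀ᵐ o ∂(M.lawO O), ∀ x₀ ∈ D o, ∃ ε > 0, ∃ g : M.ExoVal K → ℝ, Integrable g (ν o) ∧
      ∀ᵐ c ∂(ν o), ∀ x ∈ Metric.ball x₀ ε ∩ D o,
        ‖fderiv ℝ (fun x' => p x' o c • M.fYOn X Y O K x' o c) x‖ ≤ g c) :
    -- the partial evaluation of `f_Y` is a function of the causal exogenous variables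
    (∀ x o u, M.fY X Y O x o u = M.fYOn X Y O K x o (fun j => u j)) ∧
    -- the decomposition
    (∀ᵐ o ∂(M.lawO O), ∀ x ∈ D o,
      Integrable (M.biasIntegrand X Y O K p x o) (densLaw (ν o) (p x o)) ∧
      HasFDerivAt (fun x' => r x' o)
        (M.partialEffect X Y O K ν p x o + M.bias X Y O K ν p x o) x) ∧
    -- no bias in the case of identifiability
    (G.IdentifiableByAdjustment X Y O →
      ∀ᵐ o ∂(M.lawO O), ∀ x ∈ D o, M.bias X Y O K ν p x o = 0) := by
  have hact := M.activeSet_subset_causalSet hfaith hXY hYO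
  have hKact : G.activeSet Y ({X} ∪ G.nonDesc X O) ⊆ K := hact.trans hK₁
  refine ⟨fun x o u => M.fY_eq_fYOn hKact x o u, ?_, fun hid => ?_⟩
  · have hreg : ∀ᵐ z ∂(M.lawXO X O), r z.1 z.2
        = ∫ c, M.fYOn X Y O K z.1 z.2 c ∂(densLaw (ν z.2) (p z.1 z.2)) := by
      filter_upwards [hr, M.ae_integral_condY hKact, hp] with z h1 h2 h3
      rw [h1, h2, h3]
    filter_upwards [hDopen, hDsupp, hrcont, hfdiff, hpdiff, hfint, hdfint, hdom,
      M.ae_lawO_ae_condX hreg] with o hDo hDs hrc hfd hpd hfi hdfi hdm hro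
    have hderiv := fun x (hx : x ∈ D o) => hasFDerivAt_integral_densLaw hDo
      (fun x => hpmeas x o) (fun x c => hpnonneg x o c) (fun x => M.measurable_fYOn X Y O K x o)
      hpd hfd hx (hfi x hx) (hdfi x hx) (hdm x hx)
    -- Two continuous functions that agree on a dense part of `D o` agree on it, and since `D o` is
    -- open the derivative transfers.
    have heq : Set.EqOn (fun x => r x o)
        (fun x => ∫ c, M.fYOn X Y O K x o c ∂(densLaw (ν o) (p x o))) (D o) := by
      have hs := subset_closure_of_ae hDo hDs hro
      have hcont : ContinuousOn (fun x => ∫ c, M.fYOn X Y O K x o c ∂(densLaw (ν o) (p x o)))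
          (D o) := fun x hx => (hderiv x hx).2.continuousAt.continuousWithinAt
      have hon : Set.EqOn (fun x => r x o)
          (fun x => ∫ c, M.fYOn X Y O K x o c ∂(densLaw (ν o) (p x o)))
          {x | x ∈ D o ∧ r x o = ∫ c, M.fYOn X Y O K x o c ∂(densLaw (ν o) (p x o))} :=
        fun x hx => hx.2
      exact hon.of_subset_closure hrc hcont (fun x hx => hx.1) hs
    intro x hx
    exact ⟨(hderiv x hx).1, (hderiv x hx).2.congr_of_eventuallyEq
      (heq.eventuallyEq_of_mem (hDo.mem_nhds hx))⟩
  · obtain ⟨W, S, J, hW, hOW, hJ, hJ', hXW, hXS, hdisj⟩ := hid.exists_separation hXO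
    -- The active part of the exogenous variables has, given `(x, o)`, a law in which `x` does not
    -- occur.
    have hlaw : ∀ᵐ z ∂(M.lawXO X O),
        (densLaw (ν z.2) (p z.1 z.2)).map (M.restrictExo hKact)
          = condDistrib (fun (u : M.Ω) (j : G.activeSet Y ({X} ∪ G.nonDesc X O)) => u j)
            (M.vec O) M.P z.2 := by
      filter_upwards [hp, M.ae_condU_map_restrictExo hKact,
        M.ae_condU_eq_of_separation hW hOW hJ hJ' hXW hXO hXS hdisj] with z h1 h2 h3
      rw [← h1, h2, h3]
    filter_upwards [hDopen, hDsupp, hptotal, hfdiff, hpdiff, hfint, hdfint, hdom,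
      M.ae_lawO_ae_condX hlaw] with o hDo hDs hpt hfd hpd hfi hdfi hdm hlo
    have hs := subset_closure_of_ae hDo hDs hlo
    -- Continuity of the density in `x` extends this from almost every `x` to every point of `D o`.
    have hall := fun x (hx : x ∈ D o) => densLaw_map_eq_of_dense (fun x => hpmeas x o)
      (hpd.mono fun c hc x hx => (hc x hx).continuousAt) hpt (M.measurable_restrictExo hKact)
      (fun x hx => hx) hx (hs hx)
    intro x hx
    exact integral_score_eq_zero hDo (fun x => hpmeas x o) (fun x c => hpnonneg x o c)
      (fun x => M.measurable_fYOn X Y O K x o) hpd hfd (M.measurable_restrictExo hKact)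
      (fun x => M.measurable_fYOn X Y O _ x o)
      (fun x c => M.fYOn_restrict subset_rfl hKact x o c) hx (hpt x hx)
      (fun x' hx' => (hall x' hx').trans (hall x hx).symm) (hfi x hx) (hdfi x hx) (hdm x hx)
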